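/- **Notation.** Let $\Lambda$ be the ring of symmetric functions over $\mathbb Z$ in infinitely many variables, with elementary, complete and power-sum symmetric functions $e_k,h_k,p_k$. Let $\langle\cdot,\cdot\rangle$ be the standard bilinear form on $\Lambda$ (the Schur functions are orthonormal; equivalently $\langle h_\lambda,m_\mu\rangle=\delta_{\lambda\mu}$, where the $m_\mu$ are the monomial symmetric functions), and let $\omega:\Lambda\to\Lambda$ be the ring involution exchanging $e_k$ and $h_k$ for all $k$. Define $h_k^*\in\Lambda$ ($k\ge1$) by inverting the power series $u=t+h_1t^2+h_2t^3+\cdots$, that is, $t=u+h_1^*u^2+h_2^*u^3+\cdots$. Put $h^*_\lambda=h^*_{\lambda_1}h^*_{\lambda_2}\cdots$ for a partition $\lambda$; these form a $\mathbb Z$-basis of $\Lambda$. Let $(g_\lambda)$ be the dual basis, $\langle g_\lambda,h^*_\mu\rangle=\delta_{\lambda\mu}$. The modified type of a permutation with cycle lengths $\rho_1,\dots,\rho_r$ (fixed points included) is the partition formed by the nonzero numbers among $\rho_1-1,\dots,\rho_r-1$, and its degree $\|\sigma\|$ is $\sum_i(\rho_i-1)$. Let $K_\lambda(n)\in\mathbb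 Z[S_n]$ be the sum of all $\sigma\in S_n$ of modified type $\lambda$. Let $\star$ be the product on $\mathbb Z[S_n]$ obtained by passing to the associated graded ring for the degree filtration: for $\sigma,\tau\in S_n$, $\sigma\star\tau=\sigma\tau$ if $\|\sigma\tau\|=\|\sigma\|+\|\tau\|$, and $\sigma\star\tau=0$ otherwise. Let $\mathcal G$ be the Farahat–Higman ring; as a $\mathbb Z$-module it is free on symbols $K_\lambda$, one for each partition $\lambda$, with natural maps $K_\lambda\mapsto K_\lambda(n)$. Macdonald's isomorphism is the $\mathbb Z$-linear isomorphism $\varphi:\Lambda\to\mathcal G$ with $\varphi(g_\lambda)=K_\lambda$ for all $\lambda$; let $\phi=\varphi^{-1}$. Let $\xi_{j;n}=\sum_{i<j}(i,j)\in\mathbb Z[S_n]$ be the Jucys–Murphy elements, and for $n\ge1$ put $$(-\Xi)^{\star k}(n)=\sum_{j=1}^n(-1)^k\,\underbrace{\xi_{j;n}\star\cdots\star\xi_{j;n}}_{k}.$$ **Proposition.** Let $k\ge1$. Then $$\phi(K_{(k)})=-p_k ,$$ where $K_{(k)}$ is the stable class of $(k+1)$-cycles. Moreover, there is a unique element $(-\Xi)^{\star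 k}\in\mathcal G$ whose image under $K_\lambda\mapsto K_\lambda(n)$ is $(-\Xi)^{\star k}(n)$ for every $n\ge1$, and it satisfies $$\omega\,\phi\bigl((-\Xi)^{\star k}\bigr)=p_k .$$ -/

import Mathlib

namespace FHSym

open MvPolynomial

/-! ### The ring of symmetric functions -/

theorem degree_toMultiset {α : Type*} (a : α →₀ ℕ) : (Finsupp.toMultiset a).card = a.degree := by
  rw [Finsupp.card_toMultiset, Finsupp.degree_apply]; rfl

theorem degree_mapDomain {α β : Type*} (f : α → β) (a : α →₀ ℕ) :
    (a.mapDomain f).degree = a.degree := by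
  rw [← degree_toMultiset, ← degree_toMultiset, ← Finsupp.toMultiset_map, Multiset.card_map]

/-- The coefficients of the complete symmetric polynomial `h_k`. -/
theorem coeff_hsymm (n k : ℕ) (a : Fin n →₀ ℕ) :
    coeff a (hsymm (Fin n) ℤ k) = if a.degree = k then 1 else 0 := by
  classical
  have hprod : ∀ s : Sym (Fin n) k, ((s.1.map X).prod : MvPolynomial (Fin n) ℤ)
      = monomial (Multiset.toFinsupp s.1) 1 := by
    intro s
    induction s.1 using Multiset.induction_on with
    | empty => simp
    | cons i s ih =>
      rw [Multiset.map_cons, Multiset.prod_cons, ih, ← Multiset.singleton_add, map_add, X,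
        monomial_mul, mul_one, Multiset.toFinsupp_singleton]
  unfold hsymm
  rw [coeff_sum]
  simp only [hprod, coeff_monomial]
  have hdeg : ∀ s : Multiset (Fin n), (Multiset.toFinsupp s).degree = s.card := by
    intro s
    rw [← degree_toMultiset, Multiset.toFinsupp_toMultiset]
  by_cases h : a.degree = k
  · rw [if_pos h]
    refine (Finset.sum_eq_single (⟨Finsupp.toMultiset a, by
      rw [degree_toMultiset]; exact h⟩ : Sym (Fin n) k) ?_ ?_).trans ?_
    · intro b _ hb
      rw [if_neg]
      rintro rfl
      apply hb
      apply Subtype.ext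
      simp
    · intro hh
      exact absurd (Finset.mem_univ (α := Sym (Fin n) k) _) hh
    · simp
  · rw [if_neg h]
    apply Finset.sum_eq_zero
    intro s _
    rw [if_neg]
    rintro rfl
    exact h ((hdeg _).trans s.2)

theorem coeff_esymm (n k : ℕ) (a : Fin n →₀ ℕ) :
    coeff a (esymm (Fin n) ℤ k) = if a.degree = k ∧ ∀ i, a i ≤ 1 then 1 else 0 := by
  classical
  have key : ∀ t : Finset (Fin n), (∑ i ∈ t, Finsupp.single i 1 : Fin n →₀ ℕ) = a ↔
      (t = a.support ∧ ∀ i, a i ≤ 1) := by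
    intro t
    have hv : ∀ j, (∑ i ∈ t, Finsupp.single i 1 : Fin n →₀ ℕ) j = if j ∈ t then 1 else 0 := by
      intro j
      simp [Finsupp.finsetSum_apply, Finsupp.single_apply]
    constructor
    · rintro rfl
      refine ⟨?_, fun i => by rw [hv]; split_ifs <;> simp⟩
      ext j
      rw [Finsupp.mem_support_iff, hv]; simp
    · rintro ⟨rfl, h⟩
      ext j
      rw [hv]
      have := h j
      by_cases hj : a j = 0
      · simp [hj]
      · simp [hj]; omega
  rw [esymm_eq_sum_monomial, coeff_sum]
  simp only [coeff_monomial, key]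
  by_cases h : ∀ i, a i ≤ 1
  · have hd : a.degree = a.support.card := by
      rw [Finsupp.degree_apply, Finset.card_eq_sum_ones]
      apply Finset.sum_congr rfl
      intro i hi
      have := h i
      have := Finsupp.mem_support_iff.1 hi
      omega
    simp only [h]
    simp [Finset.sum_ite_eq', Finset.mem_powersetCard, hd]
  · simp [h]

/-- Setting the last of `n + 1` variables equal to zero. -/
noncomputable def restrict (n : ℕ) : MvPolynomial (Fin (n + 1)) ℤ →ₐ[ℤ] MvPolynomial (Fin n) ℤ :=
  killCompl (Fin.castSucc_injective n)

theorem coeff_restrict (n : ℕ) (a : Fin n →₀ ℕ) (f : MvPolynomial (Fin (n + 1)) ℤ) :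
    coeff a (restrict n f) = coeff (a.mapDomain Fin.castSucc) f := coeff_killCompl _

theorem restrict_hsymm (n k : ℕ) : restrict n (hsymm (Fin (n + 1)) ℤ k) = hsymm (Fin n) ℤ k := by
  ext a
  rw [coeff_restrict, coeff_hsymm, coeff_hsymm, degree_mapDomain]

theorem restrict_esymm (n k : ℕ) : restrict n (esymm (Fin (n + 1)) ℤ k) = esymm (Fin n) ℤ k := by
  ext a
  rw [coeff_restrict, coeff_esymm, coeff_esymm, degree_mapDomain]
  congr 2
  rw [Fin.forall_fin_succ']
  simp only [Finsupp.mapDomain_apply (Fin.castSucc_injective n)]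
  rw [Finsupp.mapDomain_of_notMem_range]
  · simp
  · rintro ⟨i, hi⟩
    exact (Fin.castSucc_ne_last i) hi

theorem restrict_psum (n k : ℕ) (hk : k ≠ 0) :
    restrict n (psum (Fin (n + 1)) ℤ k) = psum (Fin n) ℤ k := by
  unfold psum
  rw [Fin.sum_univ_castSucc, map_add, map_sum, map_pow]
  have h1 : restrict n (X (Fin.last n)) = 0 := by
    unfold restrict killCompl
    rw [aeval_X, dif_neg]
    rintro ⟨i, hi⟩
    exact (Fin.castSucc_ne_last i) hi
  rw [h1, zero_pow hk, add_zero]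
  refine Finset.sum_congr rfl fun i _ => ?_
  rw [map_pow, ← rename_X, restrict, killCompl_rename_app]

theorem isHomogeneous_hsymm (n k : ℕ) : (hsymm (Fin n) ℤ k).IsHomogeneous k := by
  intro a ha
  rw [coeff_hsymm] at ha
  rw [show Finsupp.weight (1 : Fin n → ℕ) a = a.degree by
    rw [Finsupp.degree_eq_weight_one]; rfl]
  by_contra h
  exact ha (if_neg h)

theorem isHomogeneous_esymm (n k : ℕ) : (esymm (Fin n) ℤ k).IsHomogeneous k := by
  intro a ha
  rw [coeff_esymm] at ha
  rw [show Finsupp.weight (1 : Fin n → ℕ) a = a.degree by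
    rw [Finsupp.degree_eq_weight_one]; rfl]
  by_contra h
  exact ha (if_neg fun h' => h h'.1)

theorem isHomogeneous_psum (n k : ℕ) : (psum (Fin n) ℤ k).IsHomogeneous k :=
  IsHomogeneous.sum _ _ _ fun i _ => by simpa using (isHomogeneous_X ℤ i).pow k

/-- The ring `Λ` of symmetric functions over `ℤ` in infinitely many variables, as the inverse limit
(in the category of graded rings) of the rings of symmetric polynomials: an element is a sequence of
symmetric polynomials `f n` in `n` variables, of bounded degree, such that setting the last variable
of `f (n + 1)` equal to zero gives `f n`. -/
def SymFun : Subalgebra ℤ (∀ n : ℕ, MvPolynomial (Fin n) ℤ) where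
  carrier := {f | (∀ n, (f n).IsSymmetric) ∧ (∀ n, restrict n (f (n + 1)) = f n) ∧
    ∃ d, ∀ n, (f n).totalDegree ≤ d}
  mul_mem' := by
    rintro f g ⟨hf, hf', d, hd⟩ ⟨hg, hg', e, he⟩
    refine ⟨fun n => (hf n).mul (hg n), fun n => ?_, d + e, fun n => ?_⟩
    · simp [hf', hg']
    · exact (totalDegree_mul _ _).trans (add_le_add (hd n) (he n))
  add_mem' := by
    rintro f g ⟨hf, hf', d, hd⟩ ⟨hg, hg', e, he⟩
    refine ⟨fun n => (hf n).add (hg n), fun n => ?_, d + e, fun n => ?_⟩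
    · simp [hf', hg']
    · refine (totalDegree_add _ _).trans (max_le ?_ ?_)
      · exact (hd n).trans (Nat.le_add_right _ _)
      · exact (he n).trans (Nat.le_add_left _ _)
  algebraMap_mem' r := by
    refine ⟨fun n => IsSymmetric.C r, fun n => ?_, 0, fun n => ?_⟩
    · exact AlgHom.commutes (restrict n) r
    · exact (totalDegree_C r).le

/-- The elementary symmetric function `e_k`. -/
noncomputable def e (k : ℕ) : SymFun :=
  ⟨fun n => esymm (Fin n) ℤ k, fun _ => esymm_isSymmetric _ _ k, fun n => restrict_esymm n k, k,
    fun n => (isHomogeneous_esymm n k).totalDegree_le⟩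

/-- The complete symmetric function `h_k`. -/
noncomputable def h (k : ℕ) : SymFun :=
  ⟨fun n => hsymm (Fin n) ℤ k, fun _ => hsymm_isSymmetric _ _ k, fun n => restrict_hsymm n k, k,
    fun n => (isHomogeneous_hsymm n k).totalDegree_le⟩

/-- The power sum `p_k = ∑ x_i ^ k`, for `k ≥ 1`. -/
noncomputable def p (k : ℕ+) : SymFun :=
  ⟨fun n => psum (Fin n) ℤ k, fun _ => psum_isSymmetric _ _ k, fun n => restrict_psum n k k.ne_zero,
    k, fun n => (isHomogeneous_psum n k).totalDegree_le⟩

/-! ### `Λ` is the polynomial ring in `e_1, e_2, …` -/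

/-- The injection `i ↦ i + 1` of `{0, …, n - 1}` into the positive integers. -/
def idx (n : ℕ) (i : Fin n) : ℕ+ := (i : ℕ).succPNat

theorem idx_val (n : ℕ) (i : Fin n) : (idx n i : ℕ) = i + 1 := rfl

theorem idx_inj (n : ℕ) : Function.Injective (idx n) := by
  intro i j hij
  have := congrArg PNat.val hij
  rw [idx_val, idx_val] at this
  exact Fin.ext (by omega)

/-- The projection of `Λ` to polynomials in `n` variables. -/
noncomputable def proj (n : ℕ) : SymFun →ₐ[ℤ] MvPolynomial (Fin n) ℤ :=
  (Pi.evalAlgHom ℤ (fun n : ℕ => MvPolynomial (Fin n) ℤ) n).comp SymFun.val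

theorem proj_apply (n : ℕ) (f : SymFun) : proj n f = f.1 n := rfl

theorem proj_aeval_e (n : ℕ) (P : MvPolynomial ℕ+ ℤ) :
    proj n (aeval (fun i : ℕ+ => e i) P) =
      (esymmAlgHom (Fin n) ℤ n (killCompl (idx_inj n) P)).1 := by
  have : (proj n).comp (aeval (fun i : ℕ+ => e i)) =
      ((symmetricSubalgebra (Fin n) ℤ).val.comp (esymmAlgHom (Fin n) ℤ n)).comp
        (killCompl (idx_inj n)) := by
    apply algHom_ext
    intro i
    simp only [AlgHom.comp_apply, aeval_X, proj_apply, Subalgebra.val_apply]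
    by_cases hi : (i : ℕ) ≤ n
    · have h0 := i.pos
      have : i = idx n ⟨i - 1, by omega⟩ := by
        apply PNat.eq; rw [idx_val]; simp; omega
      rw [this, ← rename_X (idx n), killCompl_rename_app,
        esymmAlgHom, aeval_X]
      rfl
    · have : killCompl (idx_inj n) (X i : MvPolynomial ℕ+ ℤ) = 0 := by
        unfold killCompl
        rw [aeval_X, dif_neg]
        rintro ⟨j, hj⟩
        have := congrArg PNat.val hj
        rw [idx_val] at this
        have := j.2
        omega
      rw [this, map_zero]
      change esymm (Fin n) ℤ i = 0
      unfold esymm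
      rw [Finset.powersetCard_eq_empty.2, Finset.sum_empty]
      simpa using hi
  exact DFunLike.congr_fun this P

theorem exists_mapDomain_idx (n : ℕ) (a : ℕ+ →₀ ℕ) (ha : ∀ i ∈ a.support, (i : ℕ) ≤ n) :
    ∃ b : Fin n →₀ ℕ, b.mapDomain (idx n) = a := by
  refine ⟨a.comapDomain _ (idx_inj n).injOn, Finsupp.mapDomain_comapDomain _ (idx_inj n) _ ?_⟩
  intro i hi
  have := ha i hi
  have h0 := i.pos
  refine ⟨⟨i - 1, by omega⟩, ?_⟩
  apply PNat.eq; rw [idx_val]; simp; omega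

theorem aeval_e_injective :
    Function.Injective (aeval (fun i : ℕ+ => e i) : MvPolynomial ℕ+ ℤ →ₐ[ℤ] SymFun) := by
  rw [injective_iff_map_eq_zero]
  intro P hP
  have hz : ∀ n, killCompl (idx_inj n) P = 0 := by
    intro n
    apply (esymmAlgEquiv (Fin n) ℤ (Fintype.card_fin n)).injective
    rw [map_zero]
    apply Subtype.ext
    have := proj_aeval_e n P
    rw [hP, map_zero] at this
    rw [esymmAlgEquiv_apply]
    exact this.symm
  ext a
  obtain ⟨b, hb⟩ := exists_mapDomain_idx (a.support.sup (fun i => (i : ℕ))) a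
    (fun i hi => Finset.le_sup (f := fun i : ℕ+ => (i : ℕ)) hi)
  rw [← hb, ← coeff_killCompl (idx_inj _), hz]
  simp

theorem esymm_weight_le (n d : ℕ) (Q : MvPolynomial (Fin n) ℤ)
    (hQ : (esymmAlgHom (Fin n) ℤ n Q).1.totalDegree ≤ d) (a : Fin n →₀ ℕ)
    (ha : coeff a Q ≠ 0) : Finsupp.weight (fun i : Fin n => (i : ℕ) + 1) a ≤ d := by
  classical
  set w : Fin n → ℕ := fun i => (i : ℕ) + 1 with hw
  have hom : ∀ (R : MvPolynomial (Fin n) ℤ) (k : ℕ), IsWeightedHomogeneous w R k →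
      (esymmAlgHom (Fin n) ℤ n R).1.IsHomogeneous k := by
    intro R k hR
    rw [esymmAlgHom_apply, aeval_def, eval₂_eq']
    apply IsHomogeneous.sum
    intro b hb
    have hb' := hR (mem_support_iff.1 hb)
    have h1 : (∏ i : Fin n, esymm (Fin n) ℤ (i + 1) ^ b i).IsHomogeneous (∑ i : Fin n, ((i : ℕ) + 1) * b i) :=
      IsHomogeneous.prod _ _ _ fun i _ => (isHomogeneous_esymm n (i + 1)).pow (b i)
    have h2 : (∑ i : Fin n, ((i : ℕ) + 1) * b i) = k := by
      rw [← hb', Finsupp.weight_apply, Finsupp.sum_fintype]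
      · simp [hw, mul_comm]
      · simp
    rw [h2] at h1
    simpa using (isHomogeneous_C (Fin n) (coeff b R)).mul h1
  by_contra hlt
  push Not at hlt
  set v := Finsupp.weight w a with hv
  have hz : esymmAlgHom (Fin n) ℤ n (weightedHomogeneousComponent w v Q) = 0 := by
    apply Subtype.ext
    have hsum : (esymmAlgHom (Fin n) ℤ n Q).1 =
        ∑ k ∈ (Q.support.image (Finsupp.weight w)),
          (esymmAlgHom (Fin n) ℤ n (weightedHomogeneousComponent w k Q)).1 := by
      have : Q = ∑ k ∈ (Q.support.image (Finsupp.weight w)), weightedHomogeneousComponent w k Q := by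
        ext b
        rw [coeff_sum]
        simp only [coeff_weightedHomogeneousComponent]
        rw [Finset.sum_ite_eq]
        split_ifs with hb
        · rfl
        · by_contra hne
          exact hb (Finset.mem_image_of_mem _ (mem_support_iff.2 hne))
      conv_lhs => rw [this]
      rw [map_sum]
      exact map_sum (symmetricSubalgebra (Fin n) ℤ).val _ _
    have h0 : homogeneousComponent v (esymmAlgHom (Fin n) ℤ n Q).1 = 0 :=
      homogeneousComponent_eq_zero _ _ (lt_of_le_of_lt hQ hlt)
    rw [hsum, map_sum, Finset.sum_eq_single v] at h0
    · rw [homogeneousComponent_of_mem (hom _ _ (weightedHomogeneousComponent_isWeightedHomogeneous v Q)),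
        if_pos rfl] at h0
      exact h0
    · intro k _ hk
      rw [homogeneousComponent_of_mem (hom _ _ (weightedHomogeneousComponent_isWeightedHomogeneous k Q)),
        if_neg hk.symm]
    · intro hk
      exact absurd (Finset.mem_image_of_mem _ (mem_support_iff.2 ha)) hk
  have hz' : weightedHomogeneousComponent w v Q = 0 := by
    apply (esymmAlgEquiv (Fin n) ℤ (Fintype.card_fin n)).injective
    rw [map_zero, esymmAlgEquiv_apply]
    exact hz
  apply ha
  have := congrArg (coeff a) hz'
  rwa [coeff_weightedHomogeneousComponent, if_pos rfl] at this

theorem aeval_e_surjective :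
    Function.Surjective (aeval (fun i : ℕ+ => e i) : MvPolynomial ℕ+ ℤ →ₐ[ℤ] SymFun) := by
  intro f
  obtain ⟨hs, hr, d, hd⟩ := f.2
  choose Q hQ using fun n => (esymmAlgEquiv (Fin n) ℤ (Fintype.card_fin n)).surjective ⟨f.1 n, hs n⟩
  have hQ' : ∀ n, (esymmAlgHom (Fin n) ℤ n (Q n)).1 = f.1 n := by
    intro n
    have := congrArg Subtype.val (hQ n)
    rwa [esymmAlgEquiv_apply] at this
  set P : ℕ → MvPolynomial ℕ+ ℤ := fun n => rename (idx n) (Q n)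
    with hP
  have hPn : ∀ n, (aeval (fun i : ℕ+ => e i) (P n)).1 n = f.1 n := by
    intro n
    rw [← proj_apply, proj_aeval_e, hP]
    simp only [killCompl_rename_app]
    exact hQ' n
  have hdown : ∀ (g : SymFun) n, g.1 (n + 1) = f.1 (n + 1) → g.1 n = f.1 n := by
    intro g n hg
    rw [← g.2.2.1 n, hg, hr]
  have hwt : ∀ n (a : ℕ+ →₀ ℕ), coeff a (P n) ≠ 0 → (∀ i ∈ a.support, (i : ℕ) ≤ d) := by
    intro n a ha i hi
    obtain ⟨b, rfl, hb⟩ := coeff_rename_ne_zero _ _ _ ha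
    have h1 := esymm_weight_le n d (Q n) (by rw [hQ']; exact hd n) b hb
    have hi' := Finsupp.mapDomain_support hi
    obtain ⟨j, hj, rfl⟩ := Finset.mem_image.1 hi'
    refine le_trans ?_ h1
    exact Finsupp.le_weight_of_ne_zero' (fun i : Fin n => (i : ℕ) + 1) (Finsupp.mem_support_iff.1 hj)
  have hstep : ∀ n, d ≤ n → P (n + 1) = P n := by
    intro n hn
    have hk : killCompl (idx_inj n) (P (n + 1)) = killCompl (idx_inj n) (P n) := by
      apply (esymmAlgEquiv (Fin n) ℤ (Fintype.card_fin n)).injective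
      apply Subtype.ext
      rw [esymmAlgEquiv_apply, esymmAlgEquiv_apply, ← proj_aeval_e, ← proj_aeval_e, proj_apply,
        proj_apply, hPn]
      exact hdown _ _ (hPn (n + 1))
    ext a
    by_cases ha : ∀ i ∈ a.support, (i : ℕ) ≤ n
    · obtain ⟨b, rfl⟩ := exists_mapDomain_idx n a ha
      rw [← coeff_killCompl (idx_inj n), ← coeff_killCompl (idx_inj n), hk]
    · have hz : ∀ m, coeff a (P m) = 0 := by
        intro m
        by_contra hne
        exact ha fun i hi => (hwt m a hne i hi).trans hn
      rw [hz, hz]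
  have hconst : ∀ n, d ≤ n → P n = P d := by
    intro n hn
    induction n, hn using Nat.le_induction with
    | base => rfl
    | succ n hn ih => rw [hstep n hn, ih]
  refine ⟨P d, Subtype.ext (funext fun n => ?_)⟩
  have hbig : ∀ n, d ≤ n → (aeval (fun i : ℕ+ => e i) (P d)).1 n = f.1 n := by
    intro n hn
    rw [← hconst n hn, hPn]
  rcases le_total d n with hn | hn
  · exact hbig n hn
  · exact Nat.decreasingInduction (motive := fun n _ => (aeval (fun i : ℕ+ => e i) (P d)).1 n = f.1 n)
      (fun n _ ih => hdown _ _ ih) (hbig d le_rfl) hn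

/-! ### The relation between the `e_k` and the `h_k` -/

theorem esymm_hsymm (n k : ℕ) (hk : k ≠ 0) :
    ∑ ij ∈ Finset.HasAntidiagonal.antidiagonal k, (-1) ^ ij.1 * esymm (Fin n) ℤ ij.1 * hsymm (Fin n) ℤ ij.2 = 0 := by
  classical
  ext a
  rw [coeff_sum, coeff_zero]
  have h1 : ∀ ij ∈ Finset.HasAntidiagonal.antidiagonal k,
      coeff a ((-1) ^ ij.1 * esymm (Fin n) ℤ ij.1 * hsymm (Fin n) ℤ ij.2) =
      ∑ S ∈ Finset.powersetCard ij.1 Finset.univ,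
        if S ⊆ a.support ∧ a.degree = k then (-1 : ℤ) ^ S.card else 0 := by
    intro ij hij
    rw [Finset.HasAntidiagonal.mem_antidiagonal] at hij
    rw [esymm_eq_sum_monomial, Finset.mul_sum, Finset.sum_mul, coeff_sum]
    refine Finset.sum_congr rfl fun S hS => ?_
    rw [Finset.mem_powersetCard] at hS
    have hv : ∀ j, (∑ i ∈ S, Finsupp.single i 1 : Fin n →₀ ℕ) j = if j ∈ S then 1 else 0 := by
      intro j
      simp [Finsupp.finsetSum_apply, Finsupp.single_apply]
    have hle : (∑ i ∈ S, Finsupp.single i 1 : Fin n →₀ ℕ) ≤ a ↔ S ⊆ a.support := by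
      constructor
      · intro hl j hj
        have := hl j
        rw [hv, if_pos hj] at this
        rw [Finsupp.mem_support_iff]; omega
      · intro hl j
        rw [hv]
        split_ifs with hj
        · have := Finsupp.mem_support_iff.1 (hl hj); omega
        · omega
    have hc : ((-1 : MvPolynomial (Fin n) ℤ)) ^ ij.1 = C ((-1 : ℤ) ^ ij.1) := by simp
    rw [hc, mul_assoc, coeff_C_mul, coeff_monomial_mul', coeff_hsymm, hS.2]
    by_cases hs : S ⊆ a.support
    · rw [if_pos (hle.2 hs)]
      have hd : a.degree = (a - ∑ i ∈ S, Finsupp.single i 1).degree + ij.1 := by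
        conv_lhs => rw [← tsub_add_cancel_of_le (hle.2 hs)]
        rw [map_add]
        congr 1
        rw [map_sum]
        simp [hS.2]
      have hiff : (a - ∑ i ∈ S, Finsupp.single i 1).degree = ij.2 ↔ a.degree = k := by omega
      simp [hs, hiff]
    · rw [if_neg (by rwa [hle]), if_neg (by tauto)]; simp
  rw [Finset.sum_congr rfl h1]
  by_cases ha : a.degree = k
  · simp only [ha, and_true]
    rw [Finset.Nat.sum_antidiagonal_eq_sum_range_succ_mk]
    have hcard : ∀ S ⊆ a.support, S.card ≤ k := by
      intro S hS
      refine (Finset.card_le_card hS).trans ?_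
      rw [← ha, Finsupp.degree_apply, Finset.card_eq_sum_ones]
      exact Finset.sum_le_sum fun i hi => Nat.one_le_iff_ne_zero.2 (Finsupp.mem_support_iff.1 hi)
    have h2 : ∑ i ∈ Finset.range k.succ, ∑ S ∈ Finset.powersetCard i (Finset.univ : Finset (Fin n)),
        (if S ⊆ a.support then (-1 : ℤ) ^ S.card else 0) =
        ∑ S ∈ a.support.powerset, (-1 : ℤ) ^ S.card := by
      rw [← Finset.sum_filter_add_sum_filter_not a.support.powerset (fun S => S.card < k.succ)]
      rw [Finset.sum_eq_zero (s := a.support.powerset.filter fun S => ¬ S.card < k.succ), add_zero]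
      · rw [Finset.sum_sigma', ← Finset.sum_filter]
        refine Finset.sum_bij' (fun x _ => x.2) (fun S _ => ⟨S.card, S⟩) ?_ ?_ ?_ ?_ ?_
        · rintro ⟨i, S⟩ hx
          simp only [Finset.mem_filter, Finset.mem_sigma, Finset.mem_range, Finset.mem_powersetCard] at hx
          simp only [Finset.mem_filter, Finset.mem_powerset]
          exact ⟨hx.2, hx.1.2.2 ▸ hx.1.1⟩
        · intro S hS
          simp only [Finset.mem_filter, Finset.mem_powerset] at hS
          simp only [Finset.mem_filter, Finset.mem_sigma, Finset.mem_range, Finset.mem_powersetCard]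
          exact ⟨⟨hS.2, Finset.subset_univ _, trivial⟩, hS.1⟩
        · rintro ⟨i, S⟩ hx
          simp only [Finset.mem_filter, Finset.mem_sigma, Finset.mem_range, Finset.mem_powersetCard] at hx
          simp only [hx.1.2.2]
        · intro S _; rfl
        · intro S _; rfl
      · intro S hS
        simp only [Finset.mem_filter, Finset.mem_powerset] at hS
        have := hcard S hS.1
        omega
    rw [h2, Finset.sum_powerset_neg_one_pow_card, if_neg]
    intro h0
    apply hk
    rw [← ha, Finsupp.degree_apply, h0, Finset.sum_empty]
  · simp [ha]

theorem e_zero : e 0 = 1 := by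
  apply Subtype.ext
  funext n
  exact esymm_zero (Fin n) ℤ

theorem h_zero : h 0 = 1 := by
  apply Subtype.ext
  funext n
  exact hsymm_zero (Fin n) ℤ

theorem e_h (k : ℕ) (hk : k ≠ 0) :
    ∑ ij ∈ Finset.HasAntidiagonal.antidiagonal k, (-1) ^ ij.1 * e ij.1 * h ij.2 = 0 := by
  apply Subtype.ext
  funext n
  have := esymm_hsymm n k hk
  rw [← proj_apply, map_sum]
  simp only [map_mul, map_pow, map_neg, map_one]
  exact this

/-! ### Triangular changes of polynomial generators -/

/-- The subring generated by the `a i` with `i < n`. -/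
def lower {R : Type*} [CommRing R] (a : ℕ+ → R) (n : ℕ+) : Subalgebra ℤ R :=
  Algebra.adjoin ℤ (a '' {i | i < n})

theorem lower_mono {R : Type*} [CommRing R] (a : ℕ+ → R) {m n : ℕ+} (hmn : m ≤ n) :
    lower a m ≤ lower a n :=
  Algebra.adjoin_mono (Set.image_mono fun _ hi => lt_of_lt_of_le hi hmn)

theorem mem_lower {R : Type*} [CommRing R] (a : ℕ+ → R) {m n : ℕ+} (hmn : m < n) :
    a m ∈ lower a n :=
  Algebra.subset_adjoin ⟨m, hmn, rfl⟩

theorem triangular_aux {R : Type*} [CommRing R] (a : ℕ+ → R)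
    (θ : R →ₐ[ℤ] R) (u : ℕ+ → ℤˣ)
    (hθ : ∀ n, θ (a n) - (u n : ℤ) • a n ∈ lower a n) (n : ℕ+) :
    ∃ y, y - ((u n)⁻¹ : ℤˣ).1 • a n ∈ lower a n ∧ θ y = a n := by
  induction n using PNat.strongInductionOn with
  | _ n ih =>
  have hsub : lower a n ≤ (lower a n).map θ := by
    refine Algebra.adjoin_le ?_
    rintro _ ⟨i, hi, rfl⟩
    obtain ⟨y, hy, hy'⟩ := ih i hi
    refine ⟨y, ?_, hy'⟩
    have h1 : y = (y - ((u i)⁻¹ : ℤˣ).1 • a i) + ((u i)⁻¹ : ℤˣ).1 • a i := by ring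
    rw [h1]
    exact add_mem (lower_mono a hi.le hy) (Subalgebra.smul_mem _ (mem_lower a hi) _)
  obtain ⟨q, hq, hq'⟩ := hsub (hθ n)
  refine ⟨((u n)⁻¹ : ℤˣ).1 • (a n - q), ?_, ?_⟩
  · rw [smul_sub, sub_sub_cancel_left]
    exact neg_mem (Subalgebra.smul_mem _ hq _)
  · have hq'' : θ q = θ (a n) - (u n : ℤ) • a n := hq'
    rw [map_zsmul, map_sub, hq'', sub_sub_cancel, smul_smul]
    simp

theorem triangular {R : Type*} [CommRing R] (a b : ℕ+ → R) (u : ℕ+ → ℤˣ)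
    (ha : Function.Bijective (aeval a : MvPolynomial ℕ+ ℤ →ₐ[ℤ] R))
    (hb : ∀ n, b n - (u n : ℤ) • a n ∈ lower a n) :
    Function.Bijective (aeval b : MvPolynomial ℕ+ ℤ →ₐ[ℤ] R) := by
  set A := AlgEquiv.ofBijective _ ha with hA
  have hAX : ∀ n, A.symm (a n) = X n := fun n => by
    rw [AlgEquiv.symm_apply_eq, hA, AlgEquiv.ofBijective_apply, aeval_X]
  set endo : (ℕ+ → R) → (R →ₐ[ℤ] R) := fun c => (aeval c).comp A.symm.toAlgHom with hend
  have hend_a : ∀ c n, endo c (a n) = c n := by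
    intro c n
    simp [hend, hAX]
  have hext : ∀ f g : R →ₐ[ℤ] R, (∀ n, f (a n) = g (a n)) → f = g := by
    intro f g hfg
    have : f.comp (aeval a) = g.comp (aeval a) := algHom_ext fun n => by simp [hfg]
    ext x
    obtain ⟨y, rfl⟩ := ha.2 x
    exact DFunLike.congr_fun this y
  have step : ∀ (c : ℕ+ → R) (v : ℕ+ → ℤˣ), (∀ n, c n - (v n : ℤ) • a n ∈ lower a n) →
      ∃ (d : ℕ+ → R), (∀ n, d n - ((v n)⁻¹ : ℤˣ).1 • a n ∈ lower a n) ∧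
        (endo c).comp (endo d) = AlgHom.id ℤ R := by
    intro c v hc
    choose d hd hd' using triangular_aux a (endo c) v (fun n => by rw [hend_a]; exact hc n)
    exact ⟨d, hd, hext _ _ fun n => by simp [hend_a, hd']⟩
  obtain ⟨d, hd, hbd⟩ := step b u hb
  obtain ⟨c, _, hdc⟩ := step d _ hd
  have hbij : Function.Bijective (endo b) := by
    have hbd' : ∀ x, endo b (endo d x) = x := fun x => DFunLike.congr_fun hbd x
    have hdc' : ∀ x, endo d (endo c x) = x := fun x => DFunLike.congr_fun hdc x
    have hdb' : ∀ x, endo d (endo b x) = x := fun x => by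
      rw [← hdc' x, hbd']
    exact ⟨Function.LeftInverse.injective hdb', Function.RightInverse.surjective hbd'⟩
  have : (aeval b : MvPolynomial ℕ+ ℤ →ₐ[ℤ] R) = (endo b).comp (aeval a) :=
    algHom_ext fun n => by simp [hend_a]
  rw [this]
  exact hbij.comp ha

theorem aeval_e_bijective :
    Function.Bijective (aeval (fun i : ℕ+ => e i) : MvPolynomial ℕ+ ℤ →ₐ[ℤ] SymFun) :=
  ⟨aeval_e_injective, aeval_e_surjective⟩

theorem h_lower (n : ℕ+) :
    h n - (((-1 : ℤˣ) ^ ((n : ℕ) + 1) : ℤˣ) : ℤ) • e n ∈ lower (fun i : ℕ+ => e i) n := by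
  induction n using PNat.strongInductionOn with
  | _ n ih =>
  have hrel := e_h n n.ne_zero
  rw [Finset.Nat.sum_antidiagonal_eq_sum_range_succ_mk, Finset.sum_range_succ,
    Finset.sum_range_eq_add_Ico _ n.pos] at hrel
  simp only [pow_zero, one_mul, e_zero, h_zero, Nat.sub_zero, Nat.sub_self, mul_one] at hrel
  have h1 : h n - (((-1 : ℤˣ) ^ ((n : ℕ) + 1) : ℤˣ) : ℤ) • e n =
      - ∑ i ∈ Finset.Ico 1 (n : ℕ), (-1) ^ i * e i * h (n - i) := by
    rw [eq_neg_iff_add_eq_zero, ← hrel]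
    simp only [zsmul_eq_mul]
    push_cast
    ring
  rw [h1]
  refine neg_mem (sum_mem fun i hi => ?_)
  rw [Finset.mem_Ico] at hi
  have hm : ∀ j : ℕ, 0 < j → j < n → e j ∈ lower (fun i : ℕ+ => e i) n := fun j h0 hj =>
    mem_lower (fun i : ℕ+ => e i) (m := ⟨j, h0⟩) hj
  refine mul_mem (mul_mem (pow_mem (neg_mem (one_mem _)) _) (hm i hi.1 hi.2)) ?_
  obtain ⟨m, hmi⟩ : ∃ m : ℕ+, (m : ℕ) = n - i := ⟨Nat.toPNat (n - i) (by omega), rfl⟩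
  have hlt : m < n := by
    rw [← PNat.coe_lt_coe, hmi]; omega
  have := ih m hlt
  rw [← hmi]
  have h2 := add_mem (lower_mono _ hlt.le this) (Subalgebra.smul_mem _ (hm m m.pos hlt)
    (((-1 : ℤˣ) ^ ((m : ℕ) + 1) : ℤˣ) : ℤ))
  simpa using h2

theorem aeval_h_bijective :
    Function.Bijective (aeval (fun i : ℕ+ => h i) : MvPolynomial ℕ+ ℤ →ₐ[ℤ] SymFun) :=
  triangular _ _ _ aeval_e_bijective h_lower

/-- The isomorphism `ℤ[X_1, X_2, …] ≃ Λ`, `X_i ↦ h_i`. -/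
noncomputable def hEquiv : MvPolynomial ℕ+ ℤ ≃ₐ[ℤ] SymFun := AlgEquiv.ofBijective _ aeval_h_bijective

theorem hEquiv_X (i : ℕ+) : hEquiv (X i) = h i := by
  rw [hEquiv, AlgEquiv.ofBijective_apply, aeval_X]

/-- The involution `ω` of `Λ`: the ring homomorphism that switches `e_k` and `h_k` for all `k`
(it is defined by `h_k ↦ e_k`; see `omega_e` for `e_k ↦ h_k`). -/
noncomputable def omega : SymFun →ₐ[ℤ] SymFun :=
  (aeval (fun i : ℕ+ => e i)).comp hEquiv.symm.toAlgHom

theorem omega_h (k : ℕ) : omega (h k) = e k := by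
  rcases Nat.eq_zero_or_pos k with rfl | hk
  · rw [h_zero, e_zero, map_one]
  · obtain ⟨m, rfl⟩ : ∃ m : ℕ+, (m : ℕ) = k := ⟨k.toPNat hk, rfl⟩
    rw [← hEquiv_X]
    simp [omega]

theorem neg_one_pow_aux {R : Type*} [CommRing R] (x j : ℕ) :
    (-1 : R) ^ (x + j + 1) * (-1) ^ (j + 1) = (-1) ^ x := by
  rw [← pow_add, show x + j + 1 + (j + 1) = x + 2 * (j + 1) by ring, pow_add, pow_mul]
  simp

theorem neg_one_pow_aux' {R : Type*} [CommRing R] (k : ℕ) : (-1 : R) ^ k * (-1) ^ k = 1 := by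
  rw [← mul_pow]
  simp

theorem omega_e (k : ℕ) : omega (e k) = h k := by
  induction k using Nat.strongRec with
  | ind k ih =>
    rcases Nat.eq_zero_or_pos k with rfl | hk
    · rw [h_zero, e_zero, map_one]
    · have h1 := congrArg omega (e_h k hk.ne')
      have h2 := e_h k hk.ne'
      rw [← Finset.Nat.sum_antidiagonal_swap] at h2
      rw [Finset.Nat.sum_antidiagonal_eq_sum_range_succ_mk, map_sum, Finset.sum_range_succ] at h1
      rw [Finset.Nat.sum_antidiagonal_eq_sum_range_succ_mk, Finset.sum_range_succ] at h2
      simp only [map_mul, map_pow, map_neg, map_one, omega_h, map_zero, Nat.sub_self, e_zero,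
        mul_one, Prod.swap, pow_zero, one_mul] at h1 h2
      have h3 : ∑ x ∈ Finset.range k, (-1) ^ x * omega (e x) * e (k - x) =
          (-1) ^ k * ∑ x ∈ Finset.range k, (-1) ^ (k - x) * e (k - x) * h x := by
        rw [Finset.mul_sum]
        refine Finset.sum_congr rfl fun x hx => ?_
        rw [Finset.mem_range] at hx
        rw [ih x hx]
        have hs : (-1 : SymFun) ^ k * (-1) ^ (k - x) = (-1) ^ x := by
          obtain ⟨j, rfl⟩ := Nat.exists_eq_add_of_lt hx
          rw [show x + j + 1 - x = j + 1 by omega]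
          exact neg_one_pow_aux x j
        rw [← hs]; ring
      rw [h3, eq_neg_of_add_eq_zero_left h2] at h1
      have h4 : (-1 : SymFun) ^ k * (omega (e k) - h k) = 0 := by
        rw [← h1]; ring
      have h5 : (-1 : SymFun) ^ k * (-1) ^ k = 1 := by
        exact neg_one_pow_aux' k
      have h6 := congrArg ((-1 : SymFun) ^ k * ·) h4
      simp only [← mul_assoc, h5, one_mul, mul_zero] at h6
      exact sub_eq_zero.1 h6

/-! ### Coefficients of symmetric functions

Partitions are finite multisets of positive integers. -/

/-- The partition formed by the nonzero exponents of a monomial. -/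
def shape {α : Type*} (a : α →₀ ℕ) : Multiset ℕ+ :=
  a.support.val.map fun i => (a i).toPNat'

theorem shape_mapDomain {α β : Type*} (f : α → β) (hf : Function.Injective f) (a : α →₀ ℕ) :
    shape (a.mapDomain f) = shape a := by
  have h1 : a.mapDomain f = a.embDomain ⟨f, hf⟩ := (Finsupp.embDomain_eq_mapDomain ⟨f, hf⟩ a).symm
  rw [h1, shape, Finsupp.support_embDomain, Finset.map_val, Multiset.map_map, shape]
  refine Multiset.map_congr rfl fun i _ => ?_
  rw [Function.comp_apply, Finsupp.embDomain_apply_self]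

/-- The size `|μ|` of a partition, the sum of its parts. -/
def size (μ : Multiset ℕ+) : ℕ := (μ.map fun i : ℕ+ => (i : ℕ)).sum

theorem size_shape {α : Type*} (a : α →₀ ℕ) : size (shape a) = a.degree := by
  rw [size, shape, Multiset.map_map, Finsupp.degree_apply]
  refine Finset.sum_congr rfl fun i hi => ?_
  exact PNat.toPNat'_coe (Nat.pos_of_ne_zero (Finsupp.mem_support_iff.1 hi))

theorem exists_perm {n : ℕ} (a b : Fin n →₀ ℕ) (hab : shape a = shape b) :
    ∃ σ : Equiv.Perm (Fin n), a.mapDomain σ = b := by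
  classical
  have hmap : ∀ c : Fin n →₀ ℕ, Finset.univ.val.map c = (shape c).map (fun i : ℕ+ => (i : ℕ)) +
      Multiset.replicate (n - (shape c).card) 0 := by
    intro c
    have hs : c.support.val = Multiset.filter (fun i => c i ≠ 0) Finset.univ.val := by
      rw [← Finset.filter_val]
      congr 1
      ext i
      simp
    have h1 : (shape c).map (fun i : ℕ+ => (i : ℕ)) =
        (Multiset.filter (fun i => c i ≠ 0) Finset.univ.val).map c := by
      rw [shape, Multiset.map_map, ← hs]
      refine Multiset.map_congr rfl fun i hi => ?_
      exact PNat.toPNat'_coe (Nat.pos_of_ne_zero (Finsupp.mem_support_iff.1 hi))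
    have h2 : (Multiset.filter (fun i => ¬ c i ≠ 0) Finset.univ.val).map c =
        Multiset.replicate (n - (shape c).card) 0 := by
      refine Multiset.eq_replicate.2 ⟨?_, ?_⟩
      · have h3 := congrArg Multiset.card
          (Multiset.filter_add_not (fun i => c i ≠ 0) (Finset.univ : Finset (Fin n)).val)
        have h4 := congrArg Multiset.card h1
        rw [Multiset.card_add] at h3
        rw [Multiset.card_map, Multiset.card_map] at h4
        rw [Multiset.card_map, h4]
        simp only [Finset.card_val, Finset.card_univ, Fintype.card_fin] at h3
        omega
      · intro x hx
        obtain ⟨i, hi, rfl⟩ := Multiset.mem_map.1 hx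
        simpa using (Multiset.mem_filter.1 hi).2
    rw [h1, ← h2, ← Multiset.map_add, Multiset.filter_add_not]
  have hcard : ∀ v, Nonempty ({i // a i = v} ≃ {i // b i = v}) := by
    intro v
    have h2 : Finset.univ.val.map a = Finset.univ.val.map b := by rw [hmap, hmap, hab]
    have h3 := congrArg (Multiset.count v) h2
    rw [Multiset.count_map, Multiset.count_map] at h3
    refine Fintype.card_eq.1 ?_
    rw [Fintype.card_subtype, Fintype.card_subtype, Finset.card_def, Finset.card_def,
      Finset.filter_val, Finset.filter_val]
    simpa [eq_comm] using h3
  refine ⟨Equiv.ofFiberEquiv fun v => (hcard v).some, ?_⟩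
  ext i
  obtain ⟨j, rfl⟩ := (Equiv.ofFiberEquiv fun v => (hcard v).some).surjective i
  rw [Finsupp.mapDomain_apply (Equiv.injective _)]
  exact (Equiv.ofFiberEquiv_map _ j).symm

theorem coeff_extend (f : SymFun) (n m : ℕ) (a : Fin n →₀ ℕ) :
    ∃ b : Fin (n + m) →₀ ℕ, shape b = shape a ∧ coeff b (f.1 (n + m)) = coeff a (f.1 n) := by
  induction m with
  | zero => exact ⟨a, rfl, rfl⟩
  | succ m ih =>
    obtain ⟨b, hb, hb'⟩ := ih
    refine ⟨b.mapDomain Fin.castSucc, ?_, ?_⟩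
    · rw [shape_mapDomain _ (Fin.castSucc_injective _), hb]
    · rw [← coeff_restrict, ← hb', ← f.2.2.1 (n + m)]; rfl

theorem coeff_eq_of_shape (f : SymFun) {n m : ℕ} (a : Fin n →₀ ℕ) (b : Fin m →₀ ℕ)
    (hab : shape a = shape b) : coeff a (f.1 n) = coeff b (f.1 m) := by
  obtain ⟨a', ha, ha'⟩ := coeff_extend f n m a
  obtain ⟨b', hb, hb'⟩ := coeff_extend f m n b
  rw [← ha', ← hb']
  have : ∀ (N M : ℕ) (_ : N = M) (a' : Fin N →₀ ℕ) (b' : Fin M →₀ ℕ), shape a' = shape b' →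
      coeff a' (f.1 N) = coeff b' (f.1 M) := by
    rintro N _ rfl a' b' h'
    obtain ⟨σ, rfl⟩ := exists_perm a' b' h'
    conv_rhs => rw [← f.2.1 N σ]
    rw [coeff_rename_mapDomain _ σ.injective]
  exact this _ _ (Nat.add_comm n m) _ _ (by rw [ha, hb, hab])

/-- An exponent vector whose exponents are the parts of `μ`. -/
noncomputable def expo (μ : Multiset ℕ+) : Fin μ.toList.length →₀ ℕ :=
  Finsupp.equivFunOnFinite.symm fun i => (μ.toList.get i : ℕ)

theorem shape_expo (μ : Multiset ℕ+) : shape (expo μ) = μ := by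
  have h1 : (expo μ).support = Finset.univ := by
    ext i
    simp [expo]
  rw [shape, h1]
  have h2 : ∀ i, (expo μ i).toPNat' = μ.toList.get i := by
    intro i
    apply PNat.eq
    rw [expo, Finsupp.equivFunOnFinite_symm_apply_apply, PNat.coe_toPNat']
  simp only [h2]
  rw [Fin.univ_val_map, List.ofFn_get, Multiset.coe_toList]

/-- The coefficient of the monomial symmetric function `m_μ` in a symmetric function, i.e. the
coefficient of any monomial whose nonzero exponents are the parts of `μ`
(see `coeff_eq_mcoeff`). -/
noncomputable def mcoeff (μ : Multiset ℕ+) : SymFun →ₗ[ℤ] ℤ :=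
  (lcoeff ℤ (expo μ)).comp (proj μ.toList.length).toLinearMap

theorem mcoeff_apply (μ : Multiset ℕ+) (f : SymFun) :
    mcoeff μ f = coeff (expo μ) (f.1 μ.toList.length) := rfl

theorem coeff_eq_mcoeff (f : SymFun) {n : ℕ} (a : Fin n →₀ ℕ) :
    coeff a (f.1 n) = mcoeff (shape a) f := by
  rw [mcoeff_apply]
  exact coeff_eq_of_shape f _ _ (shape_expo _).symm

theorem ext_mcoeff {f g : SymFun} (hfg : ∀ μ, mcoeff μ f = mcoeff μ g) : f = g := by
  apply Subtype.ext
  funext n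
  ext a
  rw [coeff_eq_mcoeff, coeff_eq_mcoeff, hfg]

theorem exists_mcoeff_bound (f : SymFun) : ∃ d, ∀ μ, d < size μ → mcoeff μ f = 0 := by
  obtain ⟨d, hd⟩ := f.2.2.2
  refine ⟨d, fun μ hμ => ?_⟩
  rw [mcoeff_apply]
  apply coeff_eq_zero_of_totalDegree_lt
  refine lt_of_le_of_lt (hd _) ?_
  rw [← shape_expo μ, size_shape, Finsupp.degree_apply] at hμ
  exact hμ

/-- The homogeneous polynomial of degree `d` in which the coefficient of a monomial depends on its
shape only, through `c`. -/
noncomputable def ofCoeff (c : Multiset ℕ+ → ℤ) (d : ℕ) (n : ℕ) : MvPolynomial (Fin n) ℤ :=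
  ∑ a ∈ Finset.finsuppAntidiag Finset.univ d, monomial a (c (shape a))

theorem coeff_ofCoeff (c : Multiset ℕ+ → ℤ) (d n : ℕ) (a : Fin n →₀ ℕ) :
    coeff a (ofCoeff c d n) = if a.degree = d then c (shape a) else 0 := by
  classical
  rw [ofCoeff, coeff_sum]
  simp only [coeff_monomial]
  rw [Finset.sum_ite_eq']
  congr 1
  rw [Finset.mem_finsuppAntidiag, Finsupp.degree_eq_sum]
  simp

theorem exists_ofCoeff (c : Multiset ℕ+ → ℤ) (d : ℕ) :
    ∃ f : SymFun, ∀ μ, mcoeff μ f = if size μ = d then c μ else 0 := by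
  refine ⟨⟨ofCoeff c d, fun n σ => ?_, fun n => ?_, d, fun n => ?_⟩, fun μ => ?_⟩
  · ext a
    obtain ⟨b, rfl⟩ : ∃ b : Fin n →₀ ℕ, b.mapDomain σ = a :=
      ⟨a.mapDomain σ.symm, by rw [← Finsupp.mapDomain_comp]; simp⟩
    rw [coeff_rename_mapDomain _ σ.injective, coeff_ofCoeff, coeff_ofCoeff, degree_mapDomain,
      shape_mapDomain _ σ.injective]
  · ext a
    rw [coeff_restrict, coeff_ofCoeff, coeff_ofCoeff, degree_mapDomain,
      shape_mapDomain _ (Fin.castSucc_injective _)]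
  · have : (ofCoeff c d n).IsHomogeneous d := by
      intro a ha
      rw [coeff_ofCoeff] at ha
      rw [show Finsupp.weight (1 : Fin n → ℕ) a = a.degree by
        rw [Finsupp.degree_eq_weight_one]; rfl]
      by_contra h
      exact ha (if_neg h)
    exact this.totalDegree_le
  · rw [mcoeff_apply]
    change coeff _ (ofCoeff c d _) = _
    rw [coeff_ofCoeff, ← size_shape, shape_expo]

/-! ### The basis `h_λ` and the standard bilinear form -/

/-- The basis of products `b_λ = b_{λ_1} b_{λ_2} ⋯`, for polynomial generators `b_1, b_2, …` of `Λ`. -/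
noncomputable def basisOfGen (b : ℕ+ → SymFun)
    (hb : Function.Bijective (aeval b : MvPolynomial ℕ+ ℤ →ₐ[ℤ] SymFun)) :
    Module.Basis (Multiset ℕ+) ℤ SymFun :=
  ((basisMonomials ℕ+ ℤ).reindex Multiset.toFinsupp.symm.toEquiv).map
    (AlgEquiv.ofBijective _ hb).toLinearEquiv

theorem basisOfGen_apply (b : ℕ+ → SymFun)
    (hb : Function.Bijective (aeval b : MvPolynomial ℕ+ ℤ →ₐ[ℤ] SymFun)) (μ : Multiset ℕ+) :
    basisOfGen b hb μ = (μ.map b).prod := by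
  have h1 : basisOfGen b hb μ = aeval b (monomial (Multiset.toFinsupp μ) (1 : ℤ)) := by
    simp [basisOfGen]
  rw [h1, aeval_monomial, map_one, one_mul]
  clear h1
  induction μ using Multiset.induction_on with
  | empty => simp
  | cons i s ih =>
    rw [← Multiset.singleton_add, map_add, Finsupp.prod_add_index' (by simp) (by simp [pow_add]), ih]
    simp

/-- The basis `h_λ = h_{λ_1} h_{λ_2} ⋯` of `Λ`. -/
noncomputable def hBasis : Module.Basis (Multiset ℕ+) ℤ SymFun :=
  basisOfGen (fun i => h i) aeval_h_bijective

/-- The standard bilinear form on `Λ`, for which `⟨m_μ, h_λ⟩ = δ_{λμ}` (equivalently, for which the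
Schur functions are orthonormal): `⟨f, h_λ⟩` is the coefficient of `m_λ` in `f`, see `hall_h`. -/
noncomputable def hall : SymFun →ₗ[ℤ] SymFun →ₗ[ℤ] ℤ := (hBasis.constr ℤ mcoeff).flip

theorem hall_h (f : SymFun) (μ : Multiset ℕ+) :
    hall f (μ.map fun i : ℕ+ => h i).prod = mcoeff μ f := by
  have h1 := basisOfGen_apply (fun i => h i) aeval_h_bijective μ
  rw [← h1, hall, LinearMap.flip_apply]
  change (hBasis.constr ℤ mcoeff) (hBasis μ) f = _
  rw [Module.Basis.constr_basis]


/-! ### The grading -/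

/-- `f` is homogeneous of degree `d`. -/
def IsHom (f : SymFun) (d : ℕ) : Prop :=
  IsWeightedHomogeneous (fun i : ℕ+ => (i : ℕ)) (hEquiv.symm f) d

theorem IsHom.mul {f g : SymFun} {a b : ℕ} (hf : IsHom f a) (hg : IsHom g b) :
    IsHom (f * g) (a + b) := by
  unfold IsHom; rw [map_mul]; exact IsWeightedHomogeneous.mul hf hg

theorem IsHom.sum {ι : Type*} (s : Finset ι) (f : ι → SymFun) (d : ℕ)
    (hf : ∀ i ∈ s, IsHom (f i) d) : IsHom (∑ i ∈ s, f i) d := by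
  unfold IsHom; rw [map_sum]; exact IsWeightedHomogeneous.sum _ _ _ hf

theorem IsHom.neg {f : SymFun} {a : ℕ} (hf : IsHom f a) : IsHom (-f) a := by
  unfold IsHom; rw [map_neg]; exact IsWeightedHomogeneous.neg hf

theorem isHom_one : IsHom 1 0 := by
  unfold IsHom; rw [map_one]; exact isWeightedHomogeneous_one _ _

theorem isHom_h (k : ℕ) : IsHom (h k) k := by
  rcases Nat.eq_zero_or_pos k with rfl | hk
  · rw [h_zero]; exact isHom_one
  · obtain ⟨m, rfl⟩ : ∃ m : ℕ+, (m : ℕ) = k := ⟨k.toPNat hk, rfl⟩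
    unfold IsHom
    rw [← hEquiv_X, AlgEquiv.symm_apply_apply]
    exact isWeightedHomogeneous_X _ _ _

theorem weight_toFinsupp (μ : Multiset ℕ+) :
    Finsupp.weight (fun i : ℕ+ => (i : ℕ)) (Multiset.toFinsupp μ) = size μ := by
  induction μ using Multiset.induction_on with
  | empty => simp [size]
  | cons i s ih =>
    rw [← Multiset.singleton_add, map_add, map_add, ih]
    simp [size, Finsupp.weight_apply]

theorem weight_eq_size (a : ℕ+ →₀ ℕ) :
    Finsupp.weight (fun i : ℕ+ => (i : ℕ)) a = size (Finsupp.toMultiset a) := by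
  rw [← weight_toFinsupp, Finsupp.toMultiset_toFinsupp]

theorem wh_aeval {σ : Type*} (w : σ → ℕ) (c : σ → MvPolynomial ℕ+ ℤ)
    (hc : ∀ i, IsWeightedHomogeneous (fun i : ℕ+ => (i : ℕ)) (c i) (w i))
    (R : MvPolynomial σ ℤ) (k : ℕ) (hR : IsWeightedHomogeneous w R k) :
    IsWeightedHomogeneous (fun i : ℕ+ => (i : ℕ)) (aeval c R) k := by
  rw [aeval_def, eval₂_eq]
  apply IsWeightedHomogeneous.sum
  intro b hb
  have hb' := hR (mem_support_iff.1 hb)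
  have h1 : IsWeightedHomogeneous (fun i : ℕ+ => (i : ℕ)) (∏ i ∈ b.support, c i ^ b i)
      (∑ i ∈ b.support, b i • w i) :=
    IsWeightedHomogeneous.prod _ _ _ fun i _ => (hc i).pow (b i)
  have h2 : (∑ i ∈ b.support, b i • w i) = k := by
    rw [← hb', Finsupp.weight_apply, Finsupp.sum]
  rw [h2] at h1
  simpa using (isWeightedHomogeneous_C (fun i : ℕ+ => (i : ℕ)) (coeff b R)).mul h1

theorem wh_inverse (c : ℕ+ → MvPolynomial ℕ+ ℤ)
    (hc : ∀ i, IsWeightedHomogeneous (fun i : ℕ+ => (i : ℕ)) (c i) i)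
    (hinj : Function.Injective (aeval c : MvPolynomial ℕ+ ℤ →ₐ[ℤ] MvPolynomial ℕ+ ℤ))
    (Q : MvPolynomial ℕ+ ℤ) (d : ℕ)
    (hQ : IsWeightedHomogeneous (fun i : ℕ+ => (i : ℕ)) (aeval c Q) d) :
    IsWeightedHomogeneous (fun i : ℕ+ => (i : ℕ)) Q d := by
  classical
  set w : ℕ+ → ℕ := fun i => (i : ℕ) with hw
  intro a ha
  by_contra hne
  set v := Finsupp.weight w a with hv
  have hsum : aeval c Q =
      ∑ k ∈ (Q.support.image (Finsupp.weight w)), aeval c (weightedHomogeneousComponent w k Q) := by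
    have : Q = ∑ k ∈ (Q.support.image (Finsupp.weight w)), weightedHomogeneousComponent w k Q := by
      ext b
      rw [coeff_sum]
      simp only [coeff_weightedHomogeneousComponent]
      rw [Finset.sum_ite_eq]
      split_ifs with hb
      · rfl
      · by_contra hne
        exact hb (Finset.mem_image_of_mem _ (mem_support_iff.2 hne))
    conv_lhs => rw [this]
    rw [map_sum]
  have hcomp : ∀ k, IsWeightedHomogeneous w (aeval c (weightedHomogeneousComponent w k Q)) k :=
    fun k => wh_aeval w c hc _ _ (weightedHomogeneousComponent_isWeightedHomogeneous k Q)
  have h0 : weightedHomogeneousComponent w v (aeval c Q) = 0 :=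
    hQ.weightedHomogeneousComponent_ne v hne
  rw [hsum, map_sum, Finset.sum_eq_single v] at h0
  · rw [(hcomp v).weightedHomogeneousComponent_same] at h0
    have hz' : weightedHomogeneousComponent w v Q = 0 := hinj (by rw [h0, map_zero])
    apply ha
    have := congrArg (coeff a) hz'
    rwa [coeff_weightedHomogeneousComponent, if_pos rfl] at this
  · intro k _ hk
    exact (hcomp k).weightedHomogeneousComponent_ne v (Ne.symm hk)
  · intro hk
    exact absurd (Finset.mem_image_of_mem _ (mem_support_iff.2 ha)) hk

/-! ### The elements `h_k^*` and the basis `h_λ^*` -/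

/-- `U(t) = t + h_1 t^2 + h_2 t^3 + …`. -/
noncomputable def U : PowerSeries SymFun :=
  PowerSeries.mk fun n => if n = 0 then 0 else h (n - 1)

/-- The elements `h_k^*` (with `h_0^* = 1`): if `u = U(t) = t + h_1 t^2 + h_2 t^3 + …`, then
`t = u + h_1^* u^2 + h_2^* u^3 + …`. The recursion compares coefficients in the latter identity,
see `subst_U`. -/
noncomputable def hstar : ℕ → SymFun
  | 0 => 1
  | n + 1 => -∑ k : Fin (n + 1), hstar k * PowerSeries.coeff (n + 2) (U ^ ((k : ℕ) + 1))

theorem U_eq : U = PowerSeries.X * PowerSeries.mk h := by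
  ext n
  rw [U, PowerSeries.coeff_mk]
  cases n with
  | zero => simp
  | succ n => rw [PowerSeries.coeff_succ_X_mul, PowerSeries.coeff_mk]; simp

theorem coeff_U_pow (m j : ℕ) :
    PowerSeries.coeff (m + j) (U ^ j) = PowerSeries.coeff m (PowerSeries.mk h ^ j) := by
  rw [U_eq, mul_pow, PowerSeries.coeff_X_pow_mul]

theorem coeff_U_pow_lt {m j : ℕ} (hmj : m < j) : PowerSeries.coeff m (U ^ j) = 0 := by
  rw [U_eq, mul_pow, PowerSeries.coeff_X_pow_mul', if_neg (by omega)]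

/-- `U` composed with `u + h_1^* u^2 + h_2^* u^3 + …` is the identity: `t = U + h_1^* U^2 + …`. -/
theorem subst_U : PowerSeries.subst U
    (PowerSeries.mk fun n => if n = 0 then 0 else hstar (n - 1)) = (PowerSeries.X : PowerSeries SymFun) := by
  have hU : PowerSeries.HasSubst U := by
    apply PowerSeries.HasSubst.of_constantCoeff_zero'
    rw [← PowerSeries.coeff_zero_eq_constantCoeff_apply, U, PowerSeries.coeff_mk, if_pos rfl]
  refine PowerSeries.ext fun n => ?_
  rw [PowerSeries.coeff_subst' hU, finsum_eq_sum_of_support_subset (s := Finset.range (n + 1))]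
  · rw [Finset.sum_range_succ']
    simp only [PowerSeries.coeff_mk, if_pos, Nat.add_sub_cancel,
      Nat.succ_ne_zero, if_false, smul_eq_mul]
    rw [PowerSeries.coeff_X]
    rcases n with _ | _ | n
    · simp
    · simp [hstar, U, h_zero]
    · rw [Finset.sum_range_succ, if_neg (by omega), hstar, Finset.sum_range]
      have := coeff_U_pow 0 (n + 2)
      rw [zero_add] at this
      rw [this]
      simp [h_zero]
  · intro k hk
    rw [Finset.coe_range, Set.mem_Iio]
    by_contra hlt
    apply hk
    change _ • PowerSeries.coeff n (U ^ k) = 0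
    rw [coeff_U_pow_lt (by omega), smul_zero]

theorem isHom_coeff_pow (j m : ℕ) : IsHom (PowerSeries.coeff m (PowerSeries.mk h ^ j)) m := by
  induction j generalizing m with
  | zero =>
    rw [pow_zero, PowerSeries.coeff_one]
    split_ifs with hm
    · rw [hm]; exact isHom_one
    · unfold IsHom; rw [map_zero]; exact isWeightedHomogeneous_zero _ _ _
  | succ j ih =>
    rw [pow_succ, PowerSeries.coeff_mul]
    refine IsHom.sum _ _ _ fun x hx => ?_
    rw [Finset.HasAntidiagonal.mem_antidiagonal] at hx
    rw [← hx, PowerSeries.coeff_mk]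
    exact (ih _).mul (isHom_h _)

theorem lower_coeff_pow (j m : ℕ) (n : ℕ+) (hm : m < n) :
    PowerSeries.coeff m (PowerSeries.mk h ^ j) ∈ lower (fun i : ℕ+ => h i) n := by
  induction j generalizing m with
  | zero =>
    rw [pow_zero, PowerSeries.coeff_one]
    split_ifs with hm
    · exact one_mem _
    · exact zero_mem _
  | succ j ih =>
    rw [pow_succ, PowerSeries.coeff_mul]
    refine sum_mem fun x hx => ?_
    rw [Finset.HasAntidiagonal.mem_antidiagonal] at hx
    refine mul_mem (ih _ (by omega)) ?_
    rw [PowerSeries.coeff_mk]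
    rcases Nat.eq_zero_or_pos x.2 with h0 | h0
    · rw [h0, h_zero]; exact one_mem _
    · have hlt : x.2.toPNat h0 < n := by
        rw [← PNat.coe_lt_coe]
        change x.2 < _
        omega
      have h1 := mem_lower (fun i : ℕ+ => h i) hlt
      rw [show ((x.2.toPNat h0 : ℕ+) : ℕ) = x.2 from rfl] at h1
      exact h1

theorem hstar_succ (n : ℕ) : hstar (n + 1) =
    -∑ k : Fin (n + 1), hstar k * PowerSeries.coeff (n + 1 - k) (PowerSeries.mk h ^ ((k : ℕ) + 1)) := by
  rw [hstar]
  refine congrArg Neg.neg (Finset.sum_congr rfl fun k _ => ?_)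
  rw [← coeff_U_pow, show n + 1 - (k : ℕ) + ((k : ℕ) + 1) = n + 2 by have := k.2; omega]

theorem isHom_hstar (n : ℕ) : IsHom (hstar n) n := by
  induction n using Nat.strongRec with
  | ind n ih =>
    cases n with
    | zero => rw [hstar]; exact isHom_one
    | succ n =>
      rw [hstar_succ]
      refine (IsHom.sum _ _ _ fun k _ => ?_).neg
      have h1 := (ih k (by omega)).mul (isHom_coeff_pow (k + 1) (n + 1 - k))
      rwa [show (k : ℕ) + (n + 1 - k) = n + 1 by omega] at h1

theorem hstar_lower (n : ℕ+) :
    hstar n - ((-1 : ℤˣ) : ℤ) • h n ∈ lower (fun i : ℕ+ => h i) n := by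
  induction n using PNat.strongInductionOn with
  | _ n ih =>
  obtain ⟨m, hm⟩ : ∃ m : ℕ, (n : ℕ) = m + 1 := ⟨n - 1, by have := n.pos; omega⟩
  rw [hm, hstar_succ, Fin.sum_univ_succ]
  simp only [Fin.val_zero, hstar, one_mul, Nat.sub_zero, zero_add, pow_one, PowerSeries.coeff_mk,
    Units.val_neg, Units.val_one, neg_smul, one_smul, sub_neg_eq_add, neg_add_rev,
    neg_add_cancel_right]
  refine neg_mem (sum_mem fun k _ => ?_)
  rw [Fin.val_succ]
  refine mul_mem ?_ (lower_coeff_pow _ _ _ (by omega))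
  have hlt : (k : ℕ).succPNat < n := by
    rw [← PNat.coe_lt_coe, Nat.succPNat_coe]; omega
  have h2 := add_mem (lower_mono _ hlt.le (ih _ hlt))
    (Subalgebra.smul_mem _ (mem_lower (fun i : ℕ+ => h i) hlt) ((-1 : ℤˣ) : ℤ))
  rw [sub_add_cancel] at h2
  exact h2

theorem aeval_hstar_bijective :
    Function.Bijective (aeval (fun i : ℕ+ => hstar i) : MvPolynomial ℕ+ ℤ →ₐ[ℤ] SymFun) :=
  triangular _ _ (fun _ => -1) aeval_h_bijective hstar_lower

/-- The basis `h_λ^*` of `Λ`. -/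
noncomputable def hstarBasis : Module.Basis (Multiset ℕ+) ℤ SymFun :=
  basisOfGen (fun i => hstar i) aeval_hstar_bijective

/-- `h_λ^* = h_{λ_1}^* h_{λ_2}^* ⋯`. -/
noncomputable def hstarProd (μ : Multiset ℕ+) : SymFun := (μ.map fun i : ℕ+ => hstar i).prod

theorem hstarBasis_apply (μ : Multiset ℕ+) : hstarBasis μ = hstarProd μ :=
  basisOfGen_apply _ _ _

theorem hBasis_apply (μ : Multiset ℕ+) : hBasis μ = (μ.map fun i : ℕ+ => h i).prod :=
  basisOfGen_apply _ _ _

theorem isHom_hstarProd (μ : Multiset ℕ+) : IsHom (hstarProd μ) (size μ) := by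
  unfold hstarProd
  induction μ using Multiset.induction_on with
  | empty => simpa [size] using isHom_one
  | cons i s ih =>
    rw [Multiset.map_cons, Multiset.prod_cons, size, Multiset.map_cons, Multiset.sum_cons]
    exact (isHom_hstar i).mul ih

theorem isHom_hBasis (μ : Multiset ℕ+) : IsHom (hBasis μ) (size μ) := by
  rw [hBasis_apply]
  induction μ using Multiset.induction_on with
  | empty => simpa [size] using isHom_one
  | cons i s ih =>
    rw [Multiset.map_cons, Multiset.prod_cons, size, Multiset.map_cons, Multiset.sum_cons]
    exact (isHom_h i).mul ih

theorem repr_basisOfGen (b : ℕ+ → SymFun)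
    (hb : Function.Bijective (aeval b : MvPolynomial ℕ+ ℤ →ₐ[ℤ] SymFun)) (f : SymFun)
    (μ : Multiset ℕ+) : (basisOfGen b hb).repr f μ =
      coeff (Multiset.toFinsupp μ) ((AlgEquiv.ofBijective _ hb).symm f) := by
  simp only [basisOfGen, Module.Basis.map_repr, LinearEquiv.trans_apply, Module.Basis.repr_reindex_apply]
  rfl

theorem hBasis_repr_eq_zero {f : SymFun} {d : ℕ} (hf : IsHom f d) {μ : Multiset ℕ+}
    (hμ : size μ ≠ d) : hBasis.repr f μ = 0 := by
  rw [hBasis, repr_basisOfGen]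
  by_contra hne
  exact hμ ((weight_toFinsupp μ).symm.trans (hf hne))

theorem hstarBasis_repr_eq_zero {f : SymFun} {d : ℕ} (hf : IsHom f d) {μ : Multiset ℕ+}
    (hμ : size μ ≠ d) : hstarBasis.repr f μ = 0 := by
  rw [hstarBasis, repr_basisOfGen]
  set Q := (AlgEquiv.ofBijective _ aeval_hstar_bijective).symm f with hQ
  have hc : ∀ R : MvPolynomial ℕ+ ℤ, aeval (fun i : ℕ+ => hEquiv.symm (hstar i)) R =
      hEquiv.symm (aeval (fun i : ℕ+ => hstar i) R) := by
    intro R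
    have : (aeval (fun i : ℕ+ => hEquiv.symm (hstar i))) =
      hEquiv.symm.toAlgHom.comp (aeval (fun i : ℕ+ => hstar i) : MvPolynomial ℕ+ ℤ →ₐ[ℤ] SymFun) :=
      algHom_ext fun i => by simp
    rw [this]; rfl
  have hfQ : aeval (fun i : ℕ+ => hstar i) Q = f := by
    rw [hQ]
    exact AlgEquiv.apply_symm_apply (AlgEquiv.ofBijective _ aeval_hstar_bijective) f
  have hwQ := wh_inverse (fun i => hEquiv.symm (hstar i)) (fun i => isHom_hstar i)
    (by
      intro x y hxy
      simp only [hc] at hxy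
      exact aeval_hstar_bijective.1 (hEquiv.symm.injective hxy)) Q d
    (by rw [hc, hfQ]; exact hf)
  by_contra hne
  exact hμ ((weight_toFinsupp μ).symm.trans (hwQ hne))

theorem hall_hBasis (f : SymFun) (μ : Multiset ℕ+) : hall f (hBasis μ) = mcoeff μ f := by
  rw [hBasis_apply, hall_h]

theorem finite_size_le (d : ℕ) : {μ : Multiset ℕ+ | size μ ≤ d}.Finite := by
  refine (Set.finite_Iic (d • (Finset.Icc 1 d.succPNat).val)).subset fun μ hμ => ?_
  rw [Set.mem_Iic, Multiset.le_iff_count]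
  intro i
  rw [Multiset.count_nsmul]
  have hle : Multiset.count i μ * (i : ℕ) ≤ d := by
    refine le_trans ?_ hμ
    have h1 := Multiset.le_count_iff_replicate_le.1 (le_refl (Multiset.count i μ))
    obtain ⟨ν, hν⟩ := Multiset.le_iff_exists_add.1 h1
    have h2 := congrArg size hν
    simp only [size, Multiset.map_add, Multiset.sum_add, Multiset.map_replicate,
      Multiset.sum_replicate, smul_eq_mul] at h2
    rw [size, h2]
    exact Nat.le_add_right _ _
  rcases Nat.eq_zero_or_pos (Multiset.count i μ) with h0 | h0
  · rw [h0]; exact Nat.zero_le _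
  · have hi : (i : ℕ) ≤ d := (Nat.le_mul_of_pos_left _ h0).trans hle
    have hmem : i ∈ Finset.Icc 1 d.succPNat := by
      rw [Finset.mem_Icc, ← PNat.coe_le_coe, ← PNat.coe_le_coe, Nat.succPNat_coe]
      exact ⟨i.pos, by omega⟩
    rw [Multiset.count_eq_one_of_mem (Finset.nodup _) hmem, mul_one]
    exact (Nat.le_mul_of_pos_right _ i.pos).trans hle

theorem hall_hstar_eq_zero {f : SymFun} {d : ℕ} (hd : ∀ μ, d < size μ → mcoeff μ f = 0)
    {μ : Multiset ℕ+} (hμ : d < size μ) : hall f (hstarProd μ) = 0 := by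
  rw [← hBasis.linearCombination_repr (hstarProd μ), Finsupp.linearCombination_apply, Finsupp.sum,
    map_sum]
  refine Finset.sum_eq_zero fun ν _ => ?_
  rw [map_smul, hall_hBasis]
  by_cases hν : size ν = size μ
  · rw [hd ν (by omega), smul_zero]
  · rw [hBasis_repr_eq_zero (isHom_hstarProd μ) hν, zero_smul]

theorem eq_of_hall {f g : SymFun} (hfg : ∀ μ, hall f (hstarProd μ) = hall g (hstarProd μ)) :
    f = g := by
  have h1 : hall f = hall g := hstarBasis.ext fun μ => by rw [hstarBasis_apply, hfg]
  exact ext_mcoeff fun μ => by rw [← hall_hBasis, ← hall_hBasis, h1]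

theorem existsUnique_dual (lam : Multiset ℕ+) :
    ∃! g : SymFun, ∀ μ, hall g (hstarProd μ) = if lam = μ then 1 else 0 := by
  obtain ⟨g, hg⟩ := exists_ofCoeff (fun μ => hstarBasis.repr (hBasis μ) lam) (size lam)
  have h1 : hall g = hstarBasis.coord lam := by
    refine hBasis.ext fun μ => ?_
    rw [hall_hBasis, hg, Module.Basis.coord_apply]
    split_ifs with hs
    · rfl
    · exact (hstarBasis_repr_eq_zero (isHom_hBasis μ) (Ne.symm hs)).symm
  refine ⟨g, fun μ => ?_, fun g' hg' => eq_of_hall fun μ => ?_⟩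
  · rw [h1, ← hstarBasis_apply, Module.Basis.coord_apply, Module.Basis.repr_self,
      Finsupp.single_apply]
    simp only [eq_comm]
  · rw [hg', h1, ← hstarBasis_apply, Module.Basis.coord_apply, Module.Basis.repr_self,
      Finsupp.single_apply]
    simp only [eq_comm]

/-- The basis `(g_λ)` of `Λ` dual to `(h_λ^*)`: the unique elements with `⟨g_λ, h_μ^*⟩ = δ_{λμ}`. -/
noncomputable def g (lam : Multiset ℕ+) : SymFun := (existsUnique_dual lam).choose

theorem hall_g (lam μ : Multiset ℕ+) : hall (g lam) (hstarProd μ) = if lam = μ then 1 else 0 :=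
  (existsUnique_dual lam).choose_spec.1 μ

theorem g_linearIndependent : LinearIndependent ℤ g := by
  rw [linearIndependent_iff]
  intro l hl
  ext μ
  have h1 := congrArg (fun f => hall f (hstarProd μ)) hl
  simp only [Finsupp.linearCombination_apply, Finsupp.sum, map_sum, LinearMap.sum_apply, map_smul,
    LinearMap.smul_apply, hall_g, map_zero, LinearMap.zero_apply] at h1
  simpa using h1

theorem g_span : ⊤ ≤ Submodule.span ℤ (Set.range g) := by
  intro f _
  obtain ⟨d, hd⟩ := exists_mcoeff_bound f
  have h1 : f = ∑ lam ∈ (finite_size_le d).toFinset, hall f (hstarProd lam) • g lam := by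
    refine eq_of_hall fun μ => ?_
    simp only [map_sum, LinearMap.sum_apply, map_smul, LinearMap.smul_apply, hall_g]
    by_cases hμ : size μ ≤ d
    · simp [hμ]
    · rw [hall_hstar_eq_zero hd (by omega)]
      simp [hμ]
  rw [h1]
  exact sum_mem fun lam _ => Submodule.smul_mem _ _ (Submodule.subset_span ⟨lam, rfl⟩)

/-- The elements `g_λ` as a `ℤ`-basis of `Λ`. -/
noncomputable def gBasis : Module.Basis (Multiset ℕ+) ℤ SymFun :=
  Module.Basis.mk g_linearIndependent g_span


theorem gBasis_apply (lam : Multiset ℕ+) : gBasis lam = g lam := by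
  rw [gBasis, Module.Basis.mk_apply]

/-! ### Symmetric groups, the Farahat-Higman product and Jucys-Murphy elements -/

/-- The modified type of a permutation: the partition whose parts are `c - 1`, for the lengths
`c ≥ 2` of the nontrivial cycles (fixed points would contribute parts `0`). -/
def modifiedType {n : ℕ} (σ : Equiv.Perm (Fin n)) : Multiset ℕ+ :=
  σ.cycleType.map fun c : ℕ => (c - 1).toPNat'

/-- The degree `‖σ‖` of a permutation, i.e. the size of its modified type. -/
def degree {n : ℕ} (σ : Equiv.Perm (Fin n)) : ℕ := size (modifiedType σ)

/-- `K_λ(n)`: the characteristic function of the conjugacy class of `S_n` of modified type `λ`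
(the zero function if there is no such class). -/
def classFun (n : ℕ) (lam : Multiset ℕ+) : Equiv.Perm (Fin n) → ℤ :=
  fun σ => if modifiedType σ = lam then 1 else 0

/-- The product `⋆` of integral functions on `S_n`: the product of the associated graded ring of
`ℤ[S_n]` for the filtration by degree. It is the convolution product in which `τ · ρ` is kept if
`‖τρ‖ = ‖τ‖ + ‖ρ‖` and is replaced by `0` if `‖τρ‖ < ‖τ‖ + ‖ρ‖`. On class functions it is the
product of `𝒢(n)`. -/
def star {n : ℕ} (a b : Equiv.Perm (Fin n) → ℤ) : Equiv.Perm (Fin n) → ℤ :=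
  fun σ => ∑ τ : Equiv.Perm (Fin n),
    if degree τ + degree (τ⁻¹ * σ) = degree σ then a τ * b (τ⁻¹ * σ) else 0

/-- The `k`-fold product `a ⋆ ⋯ ⋆ a`; for `k = 0` it is the unit (the identity permutation). -/
def starPow {n : ℕ} (a : Equiv.Perm (Fin n) → ℤ) : ℕ → Equiv.Perm (Fin n) → ℤ
  | 0 => Pi.single 1 1
  | k + 1 => star (starPow a k) a

/-- The Jucys-Murphy element `ξ_{j;n} = ∑_{i < j} (i, j)` of `ℤ[S_n]`. -/
def jucysMurphy (n : ℕ) (j : Fin n) : Equiv.Perm (Fin n) → ℤ :=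
  ∑ i ∈ Finset.Iio j, Pi.single (Equiv.swap i j) 1

/-- `(-Ξ)^{⋆k}(n) = ∑_j (-1)^k ξ_{j;n} ⋆ ⋯ ⋆ ξ_{j;n}` (`k` factors). -/
def negXiStar (k n : ℕ) : Equiv.Perm (Fin n) → ℤ :=
  ∑ j : Fin n, (-1 : ℤ) ^ k • starPow (jucysMurphy n j) k

/-- The Farahat-Higman ring `𝒢` as a `ℤ`-module: it is free on symbols `K_λ`, one for each
partition `λ`. (The pointwise product of functions is *not* the product of `𝒢`.) -/
abbrev FH : Type := Multiset ℕ+ →₀ ℤ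

/-- The basis element `K_λ` of `𝒢`, the stable class of modified type `λ`. -/
noncomputable def K (lam : Multiset ℕ+) : FH := Finsupp.single lam 1

/-- The natural map `𝒢 → 𝒢(n)`, `K_λ ↦ K_λ(n)`. -/
noncomputable def toLevel (n : ℕ) : FH →ₗ[ℤ] (Equiv.Perm (Fin n) → ℤ) :=
  Finsupp.linearCombination ℤ (classFun n)

/-- Macdonald's isomorphism `φ : Λ → 𝒢`, the linear map with `g_λ ↦ K_λ`. -/
noncomputable def macdonald : SymFun ≃ₗ[ℤ] FH := gBasis.repr

theorem macdonald_g (lam : Multiset ℕ+) : macdonald (g lam) = K lam := by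
  rw [macdonald, ← gBasis_apply, Module.Basis.repr_self, K]

/-- The inverse `𝒢 → Λ` of Macdonald's isomorphism. -/
noncomputable def phi : FH ≃ₗ[ℤ] SymFun := macdonald.symm

end FHSym

namespace FHSym

open MvPolynomial

/-! ### Power sums -/

/-! Since `phi` sends $K_\lambda$ to $g_\lambda$, the first claim says $g_{(k)} = -p_k$, that is,
$\langle p_k, h^*_\mu\rangle = -\delta_{(k)\mu}$. As $p_k = m_{(k)}$, pairing with $p_k$ extracts
the coefficient of $h_k$ in a polynomial in $h_1, h_2, \dots$. This functional obeys the Leibniz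
rule relative to the constant term (`hall_p_mul`), so it kills every product of two elements of
positive degree. Only $\mu = (i)$ can contribute; the degree forces $i = k$, and $h_k^* \equiv -h_k$
modulo polynomials in the $h_i$ with $i < k$ gives $-1$ (`hall_p_hstarProd`, `g_singleton`).

For the second claim, multiplying a cycle with largest element $j$ by $(i,j)$ raises the degree
exactly when $i$ is not in the cycle, and then $i$ is inserted next to $j$. Hence $\xi_{j;n}^{\star
k}$ is the sum, with all coefficients 1, of the $(k+1)$-cycles whose largest element is $j$
(`starPow_jucysMurphy`). Every $(k+1)$-cycle has one largest element, so summing over $j$ gives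
$(-1)^k K_{(k)}(n)$ (`negXiStar_eq`). The stable element is therefore $(-1)^k K_{(k)}$; it is unique
because every partition is the modified type of some permutation (`eq_of_toLevel`).

Finally $\omega(p_k) = (-1)^{k-1}p_k$ (`omega_p`), by comparing Newton's identities for the $e_k$
and the $h_k$. So $\omega\phi$ of the stable element is $(-1)^k \cdot (-1) \cdot (-1)^{k-1} p_k =
p_k$. -/

theorem mul_e_eq_sum (n : ℕ) : ((n : SymFun) + 1) * e (n + 1) =
    ∑ x ∈ Finset.HasAntidiagonal.antidiagonal n, (-1) ^ x.1 * p x.1.succPNat * e x.2 := by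
  apply Subtype.ext
  funext m
  rw [← proj_apply, ← proj_apply, map_sum]
  simp only [map_mul, map_add, map_pow, map_neg, map_one, map_natCast]
  have h1 := mul_esymm_eq_sum (Fin m) ℤ (n + 1)
  -- The filter removes the term with power sum index 0. Shifting that index by one gives a full
  -- antidiagonal of `n`, so that only $p_1, p_2, \dots$ occur, as they do in `SymFun`.
  have h2 : ∑ a ∈ Finset.HasAntidiagonal.antidiagonal (n + 1) with a.1 < n + 1,
      (-1) ^ a.1 * esymm (Fin m) ℤ a.1 * psum (Fin m) ℤ a.2 =
      ∑ x ∈ Finset.HasAntidiagonal.antidiagonal n,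
        (-1) ^ x.2 * esymm (Fin m) ℤ x.2 * psum (Fin m) ℤ (x.1 + 1) := by
    symm
    refine Finset.sum_bij (fun x _ => (x.2, x.1 + 1)) ?_ ?_ ?_ fun _ _ => rfl
    · intro x hx
      simp only [Finset.HasAntidiagonal.mem_antidiagonal, Finset.mem_filter] at hx ⊢
      omega
    · intro x _ y _ hxy
      simp only [Prod.mk.injEq] at hxy
      exact Prod.ext (by omega) hxy.1
    · intro y hy
      simp only [Finset.HasAntidiagonal.mem_antidiagonal, Finset.mem_filter] at hy
      refine ⟨(y.2 - 1, y.1), ?_, ?_⟩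
      · simp only [Finset.HasAntidiagonal.mem_antidiagonal]; omega
      · exact Prod.ext rfl (by simp only; omega)
  rw [h2, Finset.mul_sum, Nat.cast_succ] at h1
  refine h1.trans (Finset.sum_congr rfl fun x hx => ?_)
  rw [Finset.HasAntidiagonal.mem_antidiagonal] at hx
  change _ = (-1) ^ x.1 * psum (Fin m) ℤ (x.1.succPNat : ℕ) * esymm (Fin m) ℤ x.2
  have hs : ((-1) ^ (n + 1 + 1) * (-1) ^ x.2 : MvPolynomial (Fin m) ℤ) = (-1) ^ x.1 := by
    rw [← hx, ← pow_add, show x.1 + x.2 + 1 + 1 + x.2 = x.1 + 2 * (x.2 + 1) by ring, pow_add,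
      pow_mul]
    simp
  rw [← hs, Nat.succPNat_coe]
  ring

/-- The generating function `∑ p_{n+1} t^n` of the power sums. -/
noncomputable def psumSeries : PowerSeries SymFun := PowerSeries.mk fun n => p n.succPNat

/-- The generating function `∑ (-1)^n e_n t^n`. -/
noncomputable def altESeries : PowerSeries SymFun := PowerSeries.mk fun n => (-1) ^ n * e n

theorem neg_one_pow_add_add {R : Type*} [CommRing R] (x y : ℕ) :
    (-1 : R) ^ (x + y + 1) * (-1) ^ x = -(-1) ^ y := by
  rw [← pow_add, show x + y + 1 + x = y + 2 * x + 1 by ring, pow_succ, pow_add, pow_mul]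
  simp

/-- Newton's identities for the $e_k$, packed into one equation: with $P(t) = \sum p_{n+1}t^n$, the
logarithmic derivative of $E(-t)$ is $-P(t)$. -/
theorem derivative_altESeries :
    PowerSeries.derivative SymFun altESeries = -(psumSeries * altESeries) := by
  ext1 n
  rw [PowerSeries.coeff_derivative, map_neg, PowerSeries.coeff_mul, altESeries, psumSeries]
  simp only [PowerSeries.coeff_mk]
  rw [mul_assoc, mul_comm (e (n + 1)), mul_e_eq_sum, Finset.mul_sum, ← Finset.sum_neg_distrib]
  refine Finset.sum_congr rfl fun x hx => ?_
  rw [Finset.HasAntidiagonal.mem_antidiagonal] at hx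
  have hs : ((-1) ^ (n + 1) * (-1) ^ x.1 : SymFun) = -(-1) ^ x.2 := by
    rw [← hx]
    exact neg_one_pow_add_add _ _
  rw [← mul_assoc, ← mul_assoc, hs]
  ring

theorem mk_h_mul_altESeries : PowerSeries.mk h * altESeries = 1 := by
  ext1 n
  rw [mul_comm, PowerSeries.coeff_mul, PowerSeries.coeff_one, altESeries]
  simp only [PowerSeries.coeff_mk]
  split_ifs with hn
  · subst hn
    simp [e_zero, h_zero]
  · exact e_h n hn

/-- Differentiating $H(t)E(-t) = 1$ turns the equation for $E(-t)$ into the one for $H(t)$. -/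
theorem derivative_mk_h :
    PowerSeries.derivative SymFun (PowerSeries.mk h) = psumSeries * PowerSeries.mk h := by
  have h1 := congrArg (PowerSeries.derivative SymFun) mk_h_mul_altESeries
  rw [Derivation.leibniz, derivative_altESeries, PowerSeries.derivative_one] at h1
  simp only [smul_eq_mul] at h1
  -- Multiplying by $H$ and replacing $H(t)E(-t)$ by 1 removes the factor $E(-t)$.
  linear_combination PowerSeries.mk h * h1 +
    (psumSeries * PowerSeries.mk h - PowerSeries.derivative SymFun (PowerSeries.mk h)) *
      mk_h_mul_altESeries

theorem mul_h_eq_sum (n : ℕ) : ((n : SymFun) + 1) * h (n + 1) =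
    ∑ x ∈ Finset.HasAntidiagonal.antidiagonal n, p x.1.succPNat * h x.2 := by
  have h1 := congrArg (PowerSeries.coeff n) derivative_mk_h
  rw [PowerSeries.coeff_derivative, PowerSeries.coeff_mul, psumSeries] at h1
  simp only [PowerSeries.coeff_mk] at h1
  rw [mul_comm, h1]

/-- Applying $\omega$ to Newton's identities for the $h_k$ gives identities of the same shape as
those for the $e_k$, with $\omega(p_{i+1})$ in place of $(-1)^i p_{i+1}$. Both families are thus the
coefficients of a series whose product with $E(t)$ is the same, and $E(t)$ has constant term 1, so
it can be cancelled. -/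
theorem omega_p_succPNat (n : ℕ) : omega (p n.succPNat) = (-1) ^ n * p n.succPNat := by
  have hE : IsUnit (PowerSeries.mk e) := by
    rw [PowerSeries.isUnit_iff_constantCoeff, ← PowerSeries.coeff_zero_eq_constantCoeff_apply,
      PowerSeries.coeff_mk, e_zero]
    exact isUnit_one
  have h1 : PowerSeries.mk (fun n : ℕ => omega (p n.succPNat)) =
      PowerSeries.mk fun n : ℕ => (-1) ^ n * p n.succPNat := by
    refine hE.mul_right_cancel ?_
    ext1 n
    have h2 := congrArg omega (mul_h_eq_sum n)
    rw [map_sum] at h2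
    simp only [map_mul, map_add, map_one, map_natCast, omega_h] at h2
    rw [PowerSeries.coeff_mul, PowerSeries.coeff_mul]
    simp only [PowerSeries.coeff_mk]
    rw [← h2, mul_e_eq_sum]
  simpa only [PowerSeries.coeff_mk] using congrArg (PowerSeries.coeff n) h1

/-- The sign $(-1)^{k-1}$ is written as $-(-1)^k$ so that it cancels against $(-1)^k$ from $-\Xi$
and the minus sign in $g_{(k)} = -p_k$. -/
theorem omega_p (k : ℕ+) : omega (p k) = -((-1 : ℤ) ^ (k : ℕ) • p k) := by
  have h1 := omega_p_succPNat (PNat.natPred k)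
  rw [PNat.succPNat_natPred] at h1
  have h2 : ((-1 : ℤ) ^ (k : ℕ)) = -(-1) ^ k.natPred := by
    rw [← PNat.natPred_add_one k, pow_succ, mul_neg_one]
  rw [h1, h2, neg_smul, neg_neg, zsmul_eq_mul]
  push_cast
  rfl

/-! ### Pairing with the power sums -/

theorem mcoeff_p (k : ℕ+) (μ : Multiset ℕ+) : mcoeff μ (p k) = if μ = {k} then 1 else 0 := by
  classical
  have hs : ∀ (n : ℕ) (i : Fin n), shape (Finsupp.single i (k : ℕ)) = {k} := by
    intro n i
    rw [shape, Finsupp.support_single _ k.ne_zero]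
    simp
  rw [mcoeff_apply]
  change coeff (expo μ) (psum (Fin μ.toList.length) ℤ k) = _
  rw [psum, coeff_sum]
  simp only [coeff_X_pow]
  split_ifs with hμ
  · subst hμ
    -- For $\mu = (k)$ the coefficient is read off in one variable, where $p_k$ is a single
    -- monomial; its exponent is determined by the degree.
    have hl : (Multiset.toList {k}).length = 1 := by simp
    have hd : (expo {k}).degree = k := by rw [← size_shape, shape_expo]; simp [size]
    have hu : ∀ i : Fin (Multiset.toList {k}).length, Finsupp.single i (k : ℕ) = expo {k} := by
      intro i
      have hi : ∀ j : Fin (Multiset.toList {k}).length, j = i := fun j => Fin.ext (by omega)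
      ext j
      rw [hi j, Finsupp.single_eq_same, ← hd, Finsupp.degree_eq_sum, Finset.sum_eq_single i]
      · intro b _ hb; exact absurd (hi b) hb
      · simp
    simp [hu]
  · refine Finset.sum_eq_zero fun i _ => if_neg fun hi => hμ ?_
    rw [← shape_expo μ, ← hi, hs]

/-- `⟨p_k, f⟩` is the coefficient of `h_k` in `f`. -/
theorem hall_p (k : ℕ+) (f : SymFun) :
    hall (p k) f = coeff (Finsupp.single k 1) (hEquiv.symm f) := by
  -- The two functionals agree on each $h_\mu$, because $p_k = m_{(k)}$ and the $m_\mu$ are dual to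
  -- the $h_\mu$.
  have h1 : hall (p k) = hBasis.coord {k} := by
    refine hBasis.ext fun μ => ?_
    rw [hall_hBasis, mcoeff_p, Module.Basis.coord_apply, Module.Basis.repr_self,
      Finsupp.single_apply]
  rw [h1, Module.Basis.coord_apply, hBasis, repr_basisOfGen, Multiset.toFinsupp_singleton]
  rfl

theorem coeff_single_one_mul {σ : Type*} (i : σ) (P Q : MvPolynomial σ ℤ) :
    coeff (Finsupp.single i 1) (P * Q) =
      coeff (Finsupp.single i 1) P * coeff 0 Q + coeff 0 P * coeff (Finsupp.single i 1) Q := by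
  classical
  rw [coeff_mul, Finsupp.antidiagonal_single]
  simp [Finset.Nat.antidiagonal_succ, add_comm]

/-- The only factorisations of the monomial $h_k$ are $h_k \cdot 1$ and $1 \cdot h_k$. So pairing
with $p_k$ is a derivation relative to the augmentation $h_i \mapsto 0$ and vanishes on products of
two elements without constant term. -/
theorem hall_p_mul (k : ℕ+) (f g : SymFun) :
    hall (p k) (f * g) = hall (p k) f * coeff 0 (hEquiv.symm g) +
      coeff 0 (hEquiv.symm f) * hall (p k) g := by
  rw [hall_p, hall_p, hall_p, map_mul, coeff_single_one_mul]

theorem hall_p_one (k : ℕ+) : hall (p k) 1 = 0 := by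
  classical
  rw [hall_p, map_one, coeff_one, if_neg]
  intro h0
  simpa using (Finsupp.single_eq_zero.1 h0.symm)

theorem coeff_zero_of_isHom {f : SymFun} {d : ℕ} (hf : IsHom f d) (hd : d ≠ 0) :
    coeff 0 (hEquiv.symm f) = 0 := by
  by_contra hne
  have h1 := hf hne
  rw [map_zero] at h1
  exact hd h1.symm

/-- A derivation relative to the augmentation that vanishes on ring generators vanishes on the whole
subring; here the generators are the $h_i$ with $i < k$, none of which is $h_k$. -/
theorem hall_p_lower (k : ℕ+) {f : SymFun} (hf : f ∈ lower (fun i : ℕ+ => h i) k) :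
    hall (p k) f = 0 := by
  classical
  refine Algebra.adjoin_induction (p := fun f _ => hall (p k) f = 0) ?_ ?_ ?_ ?_ hf
  · rintro _ ⟨i, hi, rfl⟩
    rw [hall_p]
    simp only
    rw [← hEquiv_X, AlgEquiv.symm_apply_apply, coeff_X, if_neg]
    intro h1
    exact (ne_of_lt hi) (Finsupp.single_left_injective one_ne_zero h1)
  · intro r
    rw [Algebra.algebraMap_eq_smul_one, map_smul, hall_p_one, smul_zero]
  · intro a b _ _ ha hb
    rw [map_add, ha, hb, add_zero]
  · intro a b _ _ ha hb
    rw [hall_p_mul, ha, hb, zero_mul, mul_zero, add_zero]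

/-- The case $i = k$ comes from the triangularity `hstar_lower`, whose diagonal entry is $-1$; for
$i \ne k$ the degrees differ. -/
theorem hall_p_hstar (k i : ℕ+) : hall (p k) (hstar i) = if i = k then -1 else 0 := by
  split_ifs with hik
  · subst hik
    have h1 := hall_p_lower i (hstar_lower i)
    rw [map_sub, map_smul, sub_eq_zero] at h1
    have h2 : hall (p i) (h i) = 1 := by
      rw [hall_p, ← hEquiv_X, AlgEquiv.symm_apply_apply, coeff_X, if_pos rfl]
    rw [h1, h2]
    rfl
  · rw [hall_p]
    by_contra hne
    have h1 := isHom_hstar i hne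
    rw [Finsupp.weight_single] at h1
    exact hik (PNat.eq (by simpa using h1.symm))

theorem hall_p_hstarProd (k : ℕ+) (μ : Multiset ℕ+) :
    hall (p k) (hstarProd μ) = if {k} = μ then -1 else 0 := by
  induction μ using Multiset.induction_on with
  | empty => simp [hstarProd, hall_p_one]
  | cons i s ih =>
    have h1 : hstarProd (i ::ₘ s) = hstar i * hstarProd s := by simp [hstarProd]
    rw [h1, hall_p_mul, coeff_zero_of_isHom (isHom_hstar i) i.ne_zero, zero_mul, add_zero]
    -- With one part the pairing is that of a single $h_i^*$. With at least two, both factors have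
    -- zero constant term and the Leibniz rule gives 0.
    rcases s.empty_or_exists_mem with rfl | ⟨j, hj⟩
    · have h2 : hstarProd 0 = 1 := by simp [hstarProd]
      rw [h2, map_one, coeff_zero_one, mul_one, hall_p_hstar]
      simp [eq_comm]
    · obtain ⟨t, rfl⟩ := Multiset.exists_cons_of_mem hj
      have h2 : size (j ::ₘ t) ≠ 0 := by simp [size]
      rw [coeff_zero_of_isHom (isHom_hstarProd _) h2, mul_zero, if_neg]
      intro h3
      simpa using congrArg Multiset.card h3

theorem g_singleton (k : ℕ+) : g {k} = -p k := by
  refine eq_of_hall fun μ => ?_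
  rw [hall_g, map_neg, LinearMap.neg_apply, hall_p_hstarProd]
  split_ifs <;> simp

theorem phi_K (lam : Multiset ℕ+) : phi (K lam) = g lam := by
  rw [phi, ← macdonald_g, LinearEquiv.symm_apply_apply]

end FHSym

namespace FHSym

/-! ### Stable classes -/

/-- A permutation lies in exactly one of the classes, so its coefficient at level $n$ is one
coordinate of `x`. This reduces uniqueness to the question of which partitions occur as modified
types. -/
theorem toLevel_apply (n : ℕ) (x : FH) (σ : Equiv.Perm (Fin n)) :
    toLevel n x σ = x (modifiedType σ) := by
  classical
  rw [toLevel, Finsupp.linearCombination_apply, Finsupp.sum_apply']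
  simp only [Pi.smul_apply, classFun, smul_eq_mul, mul_ite, mul_one, mul_zero]
  rw [Finsupp.sum_ite_eq]
  split_ifs with h1
  · rfl
  · exact (Finsupp.notMem_support_iff.1 h1).symm

theorem exists_modifiedType (lam : Multiset ℕ+) :
    ∃ n : ℕ, 1 ≤ n ∧ ∃ σ : Equiv.Perm (Fin n), modifiedType σ = lam := by
  set m : Multiset ℕ := lam.map fun i : ℕ+ => (i : ℕ) + 1 with hm
  -- The cycles, of lengths $\lambda_i + 1$, fit into `m.sum` points; the additional point ensures
  -- $n \ge 1$ even for the empty partition.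
  obtain ⟨σ, hσ⟩ := (Equiv.Perm.exists_with_cycleType_iff (Fin (m.sum + 1)) (m := m)).2
    ⟨by simp, fun a ha => by
      obtain ⟨i, _, rfl⟩ := Multiset.mem_map.1 ha
      have := i.pos
      omega⟩
  refine ⟨m.sum + 1, by omega, σ, ?_⟩
  rw [modifiedType, hσ, hm, Multiset.map_map]
  conv_rhs => rw [← Multiset.map_id lam]
  refine Multiset.map_congr rfl fun i _ => ?_
  apply PNat.eq
  simp

theorem eq_of_toLevel {x y : FH} (hxy : ∀ n : ℕ, 1 ≤ n → toLevel n x = toLevel n y) : x = y := by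
  ext lam
  obtain ⟨n, hn, σ, rfl⟩ := exists_modifiedType lam
  rw [← toLevel_apply, ← toLevel_apply, hxy n hn]

/-! ### Powers of Jucys-Murphy elements -/

theorem degree_eq_sum {n : ℕ} (σ : Equiv.Perm (Fin n)) :
    degree σ = (σ.cycleType.map fun c => c - 1).sum := by
  rw [degree, size, modifiedType, Multiset.map_map]
  refine congrArg _ (Multiset.map_congr rfl fun c hc => ?_)
  have := Equiv.Perm.two_le_of_mem_cycleType hc
  rw [Function.comp_apply, PNat.toPNat'_coe (by omega)]

/-- The degree is the size of the support minus the number of nontrivial cycles, of which there is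
at least one unless `σ = 1`; for the identity the truncated subtraction gives 0. -/
theorem degree_le {n : ℕ} (σ : Equiv.Perm (Fin n)) : degree σ ≤ σ.support.card - 1 := by
  rw [degree_eq_sum, ← Equiv.Perm.sum_cycleType]
  have h1 : ∀ c ∈ σ.cycleType, 2 ≤ c := fun _ => Equiv.Perm.two_le_of_mem_cycleType
  generalize σ.cycleType = m at h1 ⊢
  induction m using Multiset.induction_on with
  | empty => simp
  | cons c s ih =>
    have h2 := ih fun c hc => h1 c (Multiset.mem_cons_of_mem hc)
    have h3 := h1 c (Multiset.mem_cons_self c s)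
    rw [Multiset.map_cons, Multiset.sum_cons, Multiset.sum_cons]
    omega

theorem degree_inv {n : ℕ} (σ : Equiv.Perm (Fin n)) : degree σ⁻¹ = degree σ := by
  rw [degree_eq_sum, degree_eq_sum, Equiv.Perm.cycleType_inv]

theorem degree_formPerm {n : ℕ} {l : List (Fin n)} (hl : l.Nodup) :
    degree l.formPerm = l.length - 1 := by
  by_cases h2 : 2 ≤ l.length
  · have h1 := (List.isCycle_formPerm hl h2).cycleType
    rw [List.support_formPerm_of_nodup l hl (by rintro x rfl; simp at h2),
      List.toFinset_card_of_nodup hl] at h1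
    rw [degree_eq_sum, h1]
    simp
  · rw [(List.formPerm_eq_one_iff l hl).2 (by omega), degree_eq_sum]
    simp only [Equiv.Perm.cycleType_one, Multiset.map_zero, Multiset.sum_zero]
    omega

/-- `σ` is a cycle `(i_k … i_1 j)` of length `k + 1` with `i_1, …, i_k < j`. -/
def IsCycleWithMax {n : ℕ} (j : Fin n) (k : ℕ) (σ : Equiv.Perm (Fin n)) : Prop :=
  ∃ l : List (Fin n), (j :: l).Nodup ∧ l.length = k ∧ (∀ i ∈ l, i < j) ∧ σ⁻¹ = (j :: l).formPerm

/-- The inverse in `IsCycleWithMax` is there because powers grow by transpositions on the right,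
whereas prepending to a list multiplies `List.formPerm` by a transposition on the left. The degree
does not see this inversion. -/
theorem IsCycleWithMax.degree_eq {n k : ℕ} {j : Fin n} {σ : Equiv.Perm (Fin n)}
    (hσ : IsCycleWithMax j k σ) : degree σ = k := by
  obtain ⟨l, hl, hk, _, hf⟩ := hσ
  rw [← degree_inv, hf, degree_formPerm hl, List.length_cons, hk, Nat.add_sub_cancel]

theorem isCycleWithMax_zero {n : ℕ} (j : Fin n) (σ : Equiv.Perm (Fin n)) :
    IsCycleWithMax j 0 σ ↔ σ = 1 := by
  constructor
  · rintro ⟨l, _, hk, _, hf⟩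
    obtain rfl := List.length_eq_zero_iff.1 hk
    simpa using hf
  · rintro rfl
    exact ⟨[], by simp, rfl, by simp, by simp⟩

/-- Multiplication by `(i, j)`, when the degree rises, extends a cycle with largest element `j`. -/
theorem IsCycleWithMax.mul_swap {n k : ℕ} {i j : Fin n} {σ : Equiv.Perm (Fin n)} (hij : i < j)
    (hσ : IsCycleWithMax j k (σ * Equiv.swap i j)) (hd : degree σ = k + 1) :
    IsCycleWithMax j (k + 1) σ ∧ i = σ j := by
  obtain ⟨l, hl, hk, hlt, hf⟩ := hσ
  have hinv : σ⁻¹ = Equiv.swap i j * (j :: l).formPerm := by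
    rw [← hf, mul_inv_rev, Equiv.swap_inv, ← mul_assoc, Equiv.swap_mul_self, one_mul]
  -- If `i` were already in the list, `σ⁻¹` would move only points of this list, which has `k + 1`
  -- entries. Its degree would then be at most `k`, against `hd`.
  have hi : i ∉ j :: l := by
    intro hi
    have h1 : σ⁻¹.support ⊆ (j :: l).toFinset := by
      intro x hx
      by_contra hxl
      rw [List.mem_toFinset] at hxl
      rw [Equiv.Perm.mem_support, hinv, Equiv.Perm.mul_apply,
        List.formPerm_apply_of_notMem hxl] at hx
      refine hx (Equiv.swap_apply_of_ne_of_ne ?_ ?_)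
      · rintro rfl; exact hxl hi
      · rintro rfl; exact hxl List.mem_cons_self
    have h2 := (Finset.card_le_card h1).trans (List.toFinset_card_le _)
    have h3 := degree_le σ⁻¹
    rw [degree_inv, hd] at h3
    rw [List.length_cons] at h2
    omega
  have hnd : (i :: j :: l).Nodup := List.nodup_cons.2 ⟨hi, hl⟩
  have hinv' : σ⁻¹ = (i :: j :: l).formPerm := by rw [hinv, List.formPerm_cons_cons]
  -- Rotating the cyclic list by one step puts the maximum `j` back in front and the new entry `i`
  -- at the end. As `σ⁻¹` sends `i` to `j`, the index `i` is recovered from `σ`.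
  refine ⟨⟨l ++ [i], ?_, by simp [hk], ?_, ?_⟩, ?_⟩
  · simpa using (List.nodup_rotate (n := 1)).2 hnd
  · intro x hx
    rcases List.mem_append.1 hx with hx | hx
    · exact hlt x hx
    · rw [List.mem_singleton.1 hx]; exact hij
  · rw [hinv', ← List.formPerm_rotate_one _ hnd]
    simp
  · rw [← Equiv.Perm.inv_eq_iff_eq, hinv', List.formPerm_apply_head _ _ _ hnd]

/-- The converse of `IsCycleWithMax.mul_swap`: the last entry of the list is `σ j`, and the
transposition with `j` strips it off. -/
theorem IsCycleWithMax.exists_mul_swap {n k : ℕ} {j : Fin n} {σ : Equiv.Perm (Fin n)}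
    (hσ : IsCycleWithMax j (k + 1) σ) :
    σ j < j ∧ IsCycleWithMax j k (σ * Equiv.swap (σ j) j) := by
  obtain ⟨l, hl, hk, hlt, hf⟩ := hσ
  obtain ⟨l', i, rfl⟩ : ∃ l' i, l = l' ++ [i] := by
    refine ⟨l.dropLast, l.getLast (by rintro rfl; simp at hk), ?_⟩
    rw [List.dropLast_append_getLast]
  have hr : (i :: j :: l').rotate 1 = j :: (l' ++ [i]) := by simp
  have hnd : (i :: j :: l').Nodup := by
    rw [← List.nodup_rotate (n := 1), hr]; exact hl
  rw [← hr, List.formPerm_rotate_one _ hnd] at hf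
  have hi : σ j = i := by
    symm
    rw [← Equiv.Perm.inv_eq_iff_eq, hf, List.formPerm_apply_head _ _ _ hnd]
  rw [hi]
  refine ⟨hlt i (by simp), l', (List.nodup_cons.1 hnd).2, by simpa using hk,
    fun x hx => hlt x (by simp [hx]), ?_⟩
  rw [mul_inv_rev, Equiv.swap_inv, hf, List.formPerm_cons_cons, ← mul_assoc,
    Equiv.swap_mul_self, one_mul]

/-! ### Products with transpositions and the powers of $\xi_{j;n}$ -/

theorem degree_swap {n : ℕ} {i j : Fin n} (hij : i ≠ j) : degree (Equiv.swap i j) = 1 := by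
  rw [← List.formPerm_pair, degree_formPerm (by simpa using hij)]
  rfl

theorem star_sum_right {n : ℕ} {ι : Type*} (s : Finset ι) (a : Equiv.Perm (Fin n) → ℤ)
    (b : ι → Equiv.Perm (Fin n) → ℤ) : star a (∑ i ∈ s, b i) = ∑ i ∈ s, star a (b i) := by
  ext σ
  simp only [star, Finset.sum_apply]
  rw [Finset.sum_comm]
  refine Finset.sum_congr rfl fun τ _ => ?_
  split_ifs
  · rw [Finset.mul_sum]
  · simp

theorem star_single {n : ℕ} (a : Equiv.Perm (Fin n) → ℤ) (ρ σ : Equiv.Perm (Fin n)) :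
    star a (Pi.single ρ 1) σ =
      if degree (σ * ρ⁻¹) + degree ρ = degree σ then a (σ * ρ⁻¹) else 0 := by
  rw [star, Finset.sum_eq_single (σ * ρ⁻¹)]
  · have h1 : (σ * ρ⁻¹)⁻¹ * σ = ρ := by group
    rw [h1, Pi.single_eq_same, mul_one]
  · intro τ _ hτ
    rw [Pi.single_eq_of_ne, mul_zero, ite_self]
    rintro rfl
    exact hτ (by group)
  · intro h1
    exact absurd (Finset.mem_univ _) h1

open Classical in
-- Such a cycle has exactly one factorisation of the required form, since its last transposition
-- must be $(\sigma(j), j)$; hence all coefficients are 1. For $k = 0$ the only such "cycle" is the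
-- identity.
theorem starPow_jucysMurphy {n : ℕ} (j : Fin n) (k : ℕ) (σ : Equiv.Perm (Fin n)) :
    starPow (jucysMurphy n j) k σ = if IsCycleWithMax j k σ then 1 else 0 := by
  induction k generalizing σ with
  | zero =>
    rw [starPow, Pi.single_apply]
    simp only [isCycleWithMax_zero]
  | succ k ih =>
    rw [starPow, jucysMurphy, star_sum_right, Finset.sum_apply]
    simp only [star_single, Equiv.swap_inv]
    -- Unfolding the last factor also unfolded the base of the remaining power, which is folded back
    -- to match `ih`.
    rw [← jucysMurphy]
    simp only [ih]
    -- The degree condition in `star` is the hypothesis that `IsCycleWithMax.mul_swap` needs, so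
    -- only the summand `i = σ j` survives.
    have key : ∀ i ∈ Finset.Iio j,
        (if degree (σ * Equiv.swap i j) + degree (Equiv.swap i j) = degree σ then
          (if IsCycleWithMax j k (σ * Equiv.swap i j) then (1 : ℤ) else 0) else 0) =
        if i = σ j then (if IsCycleWithMax j (k + 1) σ then 1 else 0) else 0 := by
      intro i hi
      rw [Finset.mem_Iio] at hi
      rw [degree_swap hi.ne, ← ite_and, ← ite_and]
      refine if_congr ⟨?_, ?_⟩ rfl rfl
      · rintro ⟨h1, h2⟩
        rw [h2.degree_eq] at h1
        exact (h2.mul_swap hi h1.symm).symm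
      · rintro ⟨rfl, h2⟩
        have h3 := h2.exists_mul_swap.2
        exact ⟨by rw [h3.degree_eq, h2.degree_eq], h3⟩
    rw [Finset.sum_congr rfl key, Finset.sum_ite_eq']
    by_cases h1 : IsCycleWithMax j (k + 1) σ
    · rw [if_pos (Finset.mem_Iio.2 h1.exists_mul_swap.1)]
    · simp [h1]

/-! ### Sorting the $(k+1)$-cycles by their largest element -/

theorem modifiedType_eq_singleton_iff {n : ℕ} (k : ℕ+) (σ : Equiv.Perm (Fin n)) :
    modifiedType σ = {k} ↔ σ.cycleType = {(k : ℕ) + 1} := by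
  rw [modifiedType, Multiset.map_eq_singleton]
  constructor
  · rintro ⟨c, hc, hck⟩
    have h1 : 2 ≤ c := Equiv.Perm.two_le_of_mem_cycleType (σ := σ) (by rw [hc]; simp)
    have h2 := congrArg PNat.val hck
    rw [PNat.toPNat'_coe (by omega)] at h2
    rw [hc, ← h2]
    congr 1
    omega
  · intro hc
    exact ⟨_, hc, PNat.eq (by simp)⟩

/-- Positivity of `k` matters here: for $k = 0$ the permutation would be the identity, whose support
does not contain `j`. -/
theorem isCycleWithMax_iff {n : ℕ} (k : ℕ+) (j : Fin n) (σ : Equiv.Perm (Fin n)) :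
    IsCycleWithMax j k σ ↔ modifiedType σ = {k} ∧ j ∈ σ.support ∧ ∀ i ∈ σ.support, i ≤ j := by
  have hk0 := k.pos
  rw [modifiedType_eq_singleton_iff]
  constructor
  · rintro ⟨l, hl, hk, hlt, hf⟩
    have hlen : 2 ≤ (j :: l).length := by rw [List.length_cons]; omega
    have hs : σ.support = (j :: l).toFinset := by
      rw [← Equiv.Perm.support_inv, hf, List.support_formPerm_of_nodup _ hl]
      rintro x hx
      rw [hx] at hlen
      simp at hlen
    refine ⟨?_, ?_, ?_⟩
    · rw [← Equiv.Perm.cycleType_inv, hf, (List.isCycle_formPerm hl hlen).cycleType, ← hf,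
        Equiv.Perm.support_inv, hs, List.toFinset_card_of_nodup hl, List.length_cons, hk]
    · rw [hs]; simp
    · intro i hi
      rw [hs, List.mem_toFinset, List.mem_cons] at hi
      rcases hi with rfl | hi
      · exact le_rfl
      · exact (hlt i hi).le
  · rintro ⟨hc, hj, hmax⟩
    have hcyc : σ⁻¹.IsCycle := by
      rw [Equiv.Perm.isCycle_inv, ← Equiv.Perm.card_cycleType_eq_one, hc]
      simp
    have hj' : j ∈ σ⁻¹.support := by rwa [Equiv.Perm.support_inv]
    -- The required list is the tail of the orbit of `j` under `σ⁻¹`, which starts at `j` and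
    -- exhausts the support because `σ⁻¹` is a cycle.
    have h0 := Equiv.Perm.toList_getElem_zero σ⁻¹ j hj'
    have hmem : ∀ i ∈ σ⁻¹.toList j, i ∈ σ.support := by
      intro i hi
      obtain ⟨h1, h2⟩ := Equiv.Perm.mem_toList_iff.1 hi
      rw [← Equiv.Perm.support_inv]
      exact (Equiv.Perm.SameCycle.mem_support_iff h1).1 h2
    have hnd := Equiv.Perm.nodup_toList σ⁻¹ j
    have hform : (σ⁻¹.toList j).formPerm = σ⁻¹ := by
      refine (Equiv.Perm.formPerm_toList _ _).trans ?_
      convert hcyc.cycleOf_eq (Equiv.Perm.mem_support.1 hj')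
    have hlen : (σ⁻¹.toList j).length = k + 1 := by
      rw [Equiv.Perm.length_toList, ← Equiv.Perm.formPerm_toList, hform, Equiv.Perm.support_inv,
        ← Equiv.Perm.sum_cycleType, hc]
      simp
    rcases hL : σ⁻¹.toList j with _ | ⟨x, l⟩
    · rw [hL] at hlen; simp at hlen
    · simp only [hL, List.getElem_cons_zero] at h0
      subst h0
      rw [hL] at hmem hnd hlen hform
      refine ⟨l, hnd, by simpa using hlen, fun i hi => ?_, hform.symm⟩
      refine lt_of_le_of_ne (hmax i (hmem i (List.mem_cons_of_mem _ hi))) ?_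
      rintro rfl
      exact (List.nodup_cons.1 hnd).1 hi

theorem negXiStar_eq (k : ℕ+) (n : ℕ) : negXiStar k n = (-1 : ℤ) ^ (k : ℕ) • classFun n {k} := by
  classical
  ext σ
  simp only [negXiStar, Finset.sum_apply, Pi.smul_apply, starPow_jucysMurphy, isCycleWithMax_iff]
  rw [← Finset.smul_sum, classFun]
  congr 1
  by_cases hσ : modifiedType σ = {k}
  · have hne : σ.support.Nonempty := by
      rw [Finset.nonempty_iff_ne_empty, Ne, Equiv.Perm.support_eq_empty_iff]
      rintro rfl
      simp [modifiedType] at hσ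
    -- A $(k+1)$-cycle is counted for exactly one `j`, the maximum of its support.
    rw [if_pos hσ, Finset.sum_eq_single (σ.support.max' hne)]
    · rw [if_pos ⟨hσ, Finset.max'_mem _ _, fun i hi => Finset.le_max' _ i hi⟩]
    · intro j _ hj
      rw [if_neg]
      rintro ⟨_, h1, h2⟩
      exact hj (le_antisymm (Finset.le_max' _ j h1) (h2 _ (Finset.max'_mem _ _)))
    · intro h1
      exact absurd (Finset.mem_univ _) h1
  · simp [hσ]

end FHSym

theorem proposition5p7 (k : ℕ+) :
    FHSym.phi (FHSym.K {k}) = -FHSym.p k ∧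
    ∃ x : FHSym.FH,
      (∀ n : ℕ, 1 ≤ n → FHSym.toLevel n x = FHSym.negXiStar k n) ∧
      (∀ y : FHSym.FH, (∀ n : ℕ, 1 ≤ n → FHSym.toLevel n y = FHSym.negXiStar k n) → y = x) ∧
      FHSym.omega (FHSym.phi x) = FHSym.p k := by
  have hphi : FHSym.phi (FHSym.K {k}) = -FHSym.p k := by
    rw [FHSym.phi_K, FHSym.g_singleton]
  have hx : ∀ n : ℕ, 1 ≤ n →
      FHSym.toLevel n ((-1 : ℤ) ^ (k : ℕ) • FHSym.K {k}) = FHSym.negXiStar k n := by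
    intro n _
    rw [map_smul, FHSym.negXiStar_eq, FHSym.toLevel, FHSym.K,
      Finsupp.linearCombination_single, one_smul]
  refine ⟨hphi, (-1 : ℤ) ^ (k : ℕ) • FHSym.K {k}, hx, fun y hy => ?_, ?_⟩
  · exact FHSym.eq_of_toLevel fun n hn => (hy n hn).trans (hx n hn).symm
  · rw [map_smul, hphi, map_smul, map_neg, FHSym.omega_p, neg_neg, smul_smul, ← mul_pow]
    simp
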